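/- Let $\mathbb D$ be the open unit disc and $\mathbb T$ the unit circle in $\mathbb C$, and let $H^2(\mathbb D^2)$ be the Hardy space of holomorphic functions $f$ on $\mathbb D^2$ with $\sup_{0\le t<1}\int_{\mathbb T^2}|f(tz,tw)|^2\,dm<\infty$, where $m$ is normalized Lebesgue measure on $\mathbb T^2$. It is a Hilbert space with $\langle f,g\rangle=\sum_{m,n\ge0}a_{m,n}\overline{b_{m,n}}$ for $f=\sum a_{m,n}z^mw^n$ and $g=\sum b_{m,n}z^mw^n$. Let $M_1$ and $M_2$ be the operators of multiplication by the coordinates $z$ and $w$ on $H^2(\mathbb D^2)$. A quotient module is a closed subspace $\mathcal Q\subseteq H^2(\mathbb D^2)$ with $M_i^*\mathcal Q\subseteq\mathcal Q$ for $i=1,2$. With $P_{\mathcal Q}$ the orthogonal projection onto $\mathcal Q$ and $Q_i=P_{\mathcal Q}M_i|_{\mathcal Q}$, the quotient module $\mathcal Q$ is called $\varphi$-doubly commuting if $$Q_1Q_2Q_2^*=Q_2^*Q_1Q_2 .$$ An inner function on $\mathbb D$ is a bounded holomorphic function on $\mathbb D$ whose radial limits exist and have modulus $1$ at almost every point of $\mathbb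 T$. **Theorem 3.9.** Let $\theta_1$ and $\theta_2$ be inner functions on $\mathbb D$. Then the quotient module $$\mathcal Q=H^2(\mathbb D^2)\ominus\theta_1(z)\theta_2(w)H^2(\mathbb D^2)$$ is $\varphi$-doubly commuting if and only if one of the following holds: (i) $\theta_1$ and $\theta_2$ are constant functions; (ii) $\theta_1$ is constant and $\theta_2(w)=c\,\dfrac{w-b}{1-\bar b w}$ for some $b\in\mathbb D$ and $c\in\mathbb T$; (iii) $\theta_2$ is constant and $\theta_1(z)=c_1z$ for some $c_1\in\mathbb T$; (iv) $\theta_1(z)=c_1z$ and $\theta_2(w)=c_2w$ for some $c_1,c_2\in\mathbb T$. -/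

import Mathlib

open MeasureTheory Set Filter Topology ComplexConjugate

noncomputable section

/-- The open unit bidisc `𝔻²`. -/
def bidisc : Set (ℂ × ℂ) := Metric.ball (0 : ℂ) 1 ×ˢ Metric.ball (0 : ℂ) 1

/-- The point `(t e^{iα}, t e^{iβ})`. -/
def torusPt (t : ℝ) (p : ℝ × ℝ) : ℂ × ℂ :=
  (t * Complex.exp (p.1 * Complex.I), t * Complex.exp (p.2 * Complex.I))

/-- The square `[0, 2π]²` of arguments of the points of the torus. -/
abbrev argBox : Set (ℝ × ℝ) := Icc (0 : ℝ) (2 * Real.pi) ×ˢ Icc (0 : ℝ) (2 * Real.pi)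

/-- The mean of `|f(t·)|²` over the torus `𝕋²` with normalized Lebesgue measure. -/
def sqMean (t : ℝ) (f : ℂ × ℂ → ℂ) : ℝ :=
  (4 * Real.pi ^ 2)⁻¹ *
    ∫ p in argBox, ‖f (torusPt t p)‖ ^ 2

namespace HardyAux

lemma isCompact_box : IsCompact argBox := isCompact_Icc.prod isCompact_Icc

/-- The character `e^{i(mα+nβ)}`. -/
def chr (k : ℕ × ℕ) (p : ℝ × ℝ) : ℂ :=
  Complex.exp (p.1 * Complex.I) ^ k.1 * Complex.exp (p.2 * Complex.I) ^ k.2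

lemma continuous_chr (k : ℕ × ℕ) : Continuous (chr k) := by unfold chr; fun_prop

lemma norm_chr (k : ℕ × ℕ) (p : ℝ × ℝ) : ‖chr k p‖ = 1 := by
  simp [chr, Complex.norm_exp_ofReal_mul_I]

lemma orth1 (m k : ℕ) : (∫ x in Icc (0 : ℝ) (2 * Real.pi),
    conj (Complex.exp (x * Complex.I) ^ m) * Complex.exp (x * Complex.I) ^ k)
    = if m = k then (2 * Real.pi : ℂ) else 0 := by
  have h0 : (0 : ℝ) ≤ 2 * Real.pi := by positivity
  rw [integral_Icc_eq_integral_Ioc, ← intervalIntegral.integral_of_le h0]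
  have h1 : ∀ x : ℝ, conj (Complex.exp (x * Complex.I) ^ m) * Complex.exp (x * Complex.I) ^ k
      = Complex.exp ((((k : ℂ) - m) * Complex.I) * x) := by
    intro x
    rw [map_pow, ← Complex.exp_conj, ← Complex.exp_nat_mul, ← Complex.exp_nat_mul,
      ← Complex.exp_add]
    congr 1
    simp
    ring
  simp_rw [h1]
  split_ifs with h
  · subst h; simp
  · have hc : ((k : ℂ) - m) * Complex.I ≠ 0 := by
      refine mul_ne_zero (sub_ne_zero.2 ?_) Complex.I_ne_zero
      exact_mod_cast (Ne.symm h)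
    rw [integral_exp_mul_complex hc]
    have h2 : Complex.exp (((k : ℂ) - m) * Complex.I * ((2 * Real.pi : ℝ) : ℂ)) = 1 := by
      rw [Complex.exp_eq_one_iff]
      refine ⟨(k : ℤ) - m, ?_⟩
      push_cast
      ring
    rw [h2]
    simp

lemma orth (j k : ℕ × ℕ) : (∫ p in argBox, conj (chr j p) * chr k p)
    = if k = j then (4 * Real.pi ^ 2 : ℂ) else 0 := by
  have h1 : ∀ p : ℝ × ℝ, conj (chr j p) * chr k p =
      (conj (Complex.exp (p.1 * Complex.I) ^ j.1) * Complex.exp (p.1 * Complex.I) ^ k.1) *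
      (conj (Complex.exp (p.2 * Complex.I) ^ j.2) * Complex.exp (p.2 * Complex.I) ^ k.2) := by
    intro p
    simp only [chr, map_mul]
    ring
  simp_rw [h1]
  rw [Measure.volume_eq_prod, setIntegral_prod_mul (fun x : ℝ =>
      conj (Complex.exp (x * Complex.I) ^ j.1) * Complex.exp (x * Complex.I) ^ k.1)
      (fun x : ℝ => conj (Complex.exp (x * Complex.I) ^ j.2) * Complex.exp (x * Complex.I) ^ k.2),
    orth1, orth1]
  by_cases h : j.1 = k.1 <;> by_cases h' : j.2 = k.2 <;> simp [h, h', Prod.ext_iff, eq_comm]; ring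

lemma volume_box : (volume : Measure (ℝ × ℝ)).real argBox = 4 * Real.pi ^ 2 := by
  have h0 : (0 : ℝ) ≤ 2 * Real.pi := by positivity
  rw [Measure.volume_eq_prod, measureReal_prod_prod]
  simp [h0]
  ring

instance : IsFiniteMeasure ((volume : Measure (ℝ × ℝ)).restrict argBox) :=
  ⟨by rw [Measure.restrict_apply_univ]; exact isCompact_box.measure_lt_top⟩

lemma integrable_box {G : ℝ × ℝ → ℂ} (hG : Continuous G) :
    Integrable G ((volume : Measure (ℝ × ℝ)).restrict argBox) :=
  hG.continuousOn.integrableOn_compact isCompact_box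

lemma hasSum_int {ι : Type*} [Countable ι] {G : ι → ℝ × ℝ → ℂ} {u : ι → ℝ} (hu : Summable u)
    (hG : ∀ i, Continuous (G i)) (hb : ∀ i p, ‖G i p‖ ≤ u i) :
    HasSum (fun i => ∫ p in argBox, G i p) (∫ p in argBox, ∑' i, G i p) := by
  refine hasSum_integral_of_summable_integral_norm (fun i => integrable_box (hG i)) ?_
  refine Summable.of_nonneg_of_le (fun i => integral_nonneg fun _ => norm_nonneg _) (fun i => ?_)
    (hu.mul_left (4 * Real.pi ^ 2))
  calc (∫ p in argBox, ‖G i p‖) ≤ ∫ p in argBox, u i :=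
        integral_mono (integrable_box (hG i)).norm (integrable_const _) fun p => hb i p
    _ = 4 * Real.pi ^ 2 * u i := by
        rw [integral_const, smul_eq_mul, measureReal_restrict_apply_univ, volume_box]

lemma coeff_int {c : ℕ × ℕ → ℂ} (hc : Summable fun k => ‖c k‖) (j : ℕ × ℕ) :
    (∫ p in argBox, conj (chr j p) * ∑' k, c k * chr k p) = 4 * Real.pi ^ 2 * c j := by
  have h := hasSum_int (G := fun k p => conj (chr j p) * (c k * chr k p)) hc
    (fun k => (Complex.continuous_conj.comp (continuous_chr j)).mul
      (continuous_const.mul (continuous_chr k)))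
    (fun k p => by simp [norm_chr])
  simp_rw [tsum_mul_left] at h
  refine h.unique ?_
  have h2 : ∀ k, (∫ p in argBox, conj (chr j p) * (c k * chr k p)) =
      if k = j then (4 * Real.pi ^ 2 * c j : ℂ) else 0 := by
    intro k
    have : ∀ p, conj (chr j p) * (c k * chr k p) = c k * (conj (chr j p) * chr k p) := by
      intro p; ring
    simp_rw [this]
    rw [integral_const_mul, orth]
    split_ifs with hk
    · subst hk; ring
    · simp
  simp_rw [h2]
  exact hasSum_ite_eq j _

lemma parseval {c : ℕ × ℕ → ℂ} (hc : Summable fun k => ‖c k‖) :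
    (∫ p in argBox, ‖∑' k, c k * chr k p‖ ^ 2) = 4 * Real.pi ^ 2 * ∑' k, ‖c k‖ ^ 2 := by
  set F : ℝ × ℝ → ℂ := fun p => ∑' k, c k * chr k p with hF
  have hsum : ∀ p, Summable fun k => c k * chr k p := fun p =>
    Summable.of_norm (by simpa [norm_chr] using hc)
  have hFc : Continuous F :=
    continuous_tsum (fun k => continuous_const.mul (continuous_chr k)) hc
      (fun k p => by simp [norm_chr])
  have hFb : ∀ p, ‖F p‖ ≤ ∑' k, ‖c k‖ := fun p =>
    (norm_tsum_le_tsum_norm (by simpa [norm_chr] using hc)).trans (by simp [norm_chr])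
  have h := hasSum_int (G := fun k p => conj (c k * chr k p) * F p)
    (hc.mul_right (∑' k, ‖c k‖))
    (fun k => (Complex.continuous_conj.comp (continuous_const.mul (continuous_chr k))).mul hFc)
    (fun k p => by
      rw [norm_mul, RCLike.norm_conj, norm_mul, norm_chr, mul_one]
      exact mul_le_mul_of_nonneg_left (hFb p) (norm_nonneg _))
  have h1 : ∀ k, (∫ p in argBox, conj (c k * chr k p) * F p)
      = ((4 * Real.pi ^ 2 * ‖c k‖ ^ 2 : ℝ) : ℂ) := by
    intro k
    have : ∀ p, conj (c k * chr k p) * F p = conj (c k) * (conj (chr k p) * F p) := by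
      intro p; rw [map_mul]; ring
    simp_rw [this]
    rw [integral_const_mul, coeff_int hc]
    push_cast
    rw [← Complex.conj_mul']
    ring
  have h2 : ∀ p, (∑' k, conj (c k * chr k p) * F p) = ((‖F p‖ ^ 2 : ℝ) : ℂ) := by
    intro p
    rw [tsum_mul_right, ← Complex.conj_tsum]
    push_cast
    rw [← Complex.conj_mul']
  simp_rw [h1, h2] at h
  rw [integral_complex_ofReal] at h
  have h3 := Complex.hasSum_ofReal.1 h
  rw [← h3.tsum_eq, tsum_mul_left]


lemma continuous_torusPt (t : ℝ) : Continuous (torusPt t) := by unfold torusPt; fun_prop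

lemma mem_bidisc {p : ℂ × ℂ} : p ∈ bidisc ↔ ‖p.1‖ < 1 ∧ ‖p.2‖ < 1 := by
  simp [bidisc]

lemma isOpen_bidisc : IsOpen bidisc := Metric.isOpen_ball.prod Metric.isOpen_ball

lemma torusPt_mem {t : ℝ} (h0 : 0 ≤ t) (h1 : t < 1) (p : ℝ × ℝ) : torusPt t p ∈ bidisc := by
  rw [mem_bidisc]
  simp [torusPt, Complex.norm_exp_ofReal_mul_I, abs_of_nonneg h0, h1]

lemma continuous_comp_torusPt {f : ℂ × ℂ → ℂ} (hf : DifferentiableOn ℂ f bidisc) {t : ℝ}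
    (h0 : 0 ≤ t) (h1 : t < 1) : Continuous fun p => f (torusPt t p) :=
  hf.continuousOn.comp_continuous (continuous_torusPt t) (torusPt_mem h0 h1)

/-- The monomial `z^m w^n`. -/
def mono (k : ℕ × ℕ) (p : ℂ × ℂ) : ℂ := p.1 ^ k.1 * p.2 ^ k.2

lemma mono_torusPt (k : ℕ × ℕ) (t : ℝ) (p : ℝ × ℝ) :
    mono k (torusPt t p) = (t : ℂ) ^ (k.1 + k.2) * chr k p := by
  simp only [mono, torusPt, chr]
  ring

lemma cauchy1 {g : ℂ → ℂ} (hg : DifferentiableOn ℂ g (Metric.ball 0 1)) {r : ℝ} (hr1 : r < 1)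
    {z : ℂ} (hz : ‖z‖ < r) :
    g z = (2 * Real.pi : ℂ)⁻¹ * ∫ x in Icc (0 : ℝ) (2 * Real.pi),
      (1 - z / (r * Complex.exp (x * Complex.I)))⁻¹ * g (r * Complex.exp (x * Complex.I)) := by
  have h0 : (0 : ℝ) ≤ 2 * Real.pi := by positivity
  have hr0 : 0 < r := (norm_nonneg z).trans_lt hz
  have h := DifferentiableOn.circleIntegral_sub_inv_smul (f := g) (c := 0) (R := r) (w := z)
    (hg.mono (Metric.closedBall_subset_ball hr1)) (by simpa using hz)
  rw [integral_Icc_eq_integral_Ioc, ← intervalIntegral.integral_of_le h0]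
  rw [circleIntegral] at h
  have h1 : ∀ x : ℝ, deriv (circleMap 0 r) x • ((circleMap 0 r x - z)⁻¹ • g (circleMap 0 r x)) =
      Complex.I * ((1 - z / (r * Complex.exp (x * Complex.I)))⁻¹ *
        g (r * Complex.exp (x * Complex.I))) := by
    intro x
    have hu : (r * Complex.exp (x * Complex.I) : ℂ) ≠ 0 :=
      mul_ne_zero (by exact_mod_cast hr0.ne') (Complex.exp_ne_zero _)
    have hne : (r * Complex.exp (x * Complex.I) : ℂ) - z ≠ 0 := by
      intro h
      rw [sub_eq_zero] at h
      rw [← h] at hz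
      simp [Complex.norm_exp_ofReal_mul_I, abs_of_pos hr0] at hz
    simp only [deriv_circleMap, circleMap, zero_add, smul_eq_mul]
    rw [one_sub_div hu]
    field_simp
  simp_rw [h1] at h
  rw [intervalIntegral.integral_const_mul, smul_eq_mul] at h
  have hpi : (2 * Real.pi : ℂ) ≠ 0 := by simp [Real.pi_ne_zero]
  have h2 := mul_left_cancel₀ Complex.I_ne_zero (h.trans (show _ = Complex.I *
    (2 * Real.pi * g z) by ring))
  rw [h2, inv_mul_cancel_left₀ hpi]

/-- Taylor coefficients by Cauchy integrals at radius `r`. -/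
def cauchyCoeff (f : ℂ × ℂ → ℂ) (r : ℝ) (k : ℕ × ℕ) : ℂ :=
  (4 * Real.pi ^ 2 : ℂ)⁻¹ * ((r : ℂ) ^ (k.1 + k.2))⁻¹ *
    ∫ p in argBox, conj (chr k p) * f (torusPt r p)

lemma conj_exp_inv (x : ℝ) :
    (Complex.exp (x * Complex.I))⁻¹ = conj (Complex.exp (x * Complex.I)) := by
  rw [← Complex.exp_conj, ← Complex.exp_neg]
  simp

lemma cauchy2 {f : ℂ × ℂ → ℂ} (hf : DifferentiableOn ℂ f bidisc) {r : ℝ} (hr1 : r < 1)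
    {q : ℂ × ℂ} (hz : ‖q.1‖ < r) (hw : ‖q.2‖ < r) :
    HasSum (fun k => cauchyCoeff f r k * mono k q) (f q) := by
  have hr0 : 0 < r := (norm_nonneg _).trans_lt hz
  have hrc : (r : ℂ) ≠ 0 := by exact_mod_cast hr0.ne'
  obtain ⟨z, w⟩ := q
  simp only at hz hw
  set u : ℝ → ℂ := fun x => r * Complex.exp (x * Complex.I) with hu
  have hune : ∀ x, u x ≠ 0 := fun x => mul_ne_zero hrc (Complex.exp_ne_zero _)
  have hun : ∀ x, ‖u x‖ = r := fun x => by
    simp [hu, Complex.norm_exp_ofReal_mul_I, abs_of_pos hr0]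
  have huc : Continuous u := by simp only [hu]; fun_prop
  have hq : ∀ {z : ℂ}, ‖z‖ < r → ∀ x, ‖z / u x‖ = ‖z‖ / r := fun h x => by rw [norm_div, hun]
  have hq1 : ∀ {z : ℂ}, ‖z‖ < r → ‖z‖ / r < 1 := fun h => (div_lt_one hr0).2 h
  have hne : ∀ {z : ℂ}, ‖z‖ < r → ∀ x, 1 - z / u x ≠ 0 := by
    intro z h x h'
    have h2 := hq h x
    rw [← sub_eq_zero.1 h'] at h2
    simp at h2
    linarith [hq1 h]
  have hut : ∀ p : ℝ × ℝ, torusPt r p = (u p.1, u p.2) := fun p => rfl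
  -- the iterated Cauchy formula
  have hA : f (z, w) = (4 * Real.pi ^ 2 : ℂ)⁻¹ * ∫ p in argBox,
      (1 - z / u p.1)⁻¹ * (1 - w / u p.2)⁻¹ * f (torusPt r p) := by
    have e1 := cauchy1 (g := fun s => f (s, w)) (r := r) (z := z) (by
      refine hf.comp (f := fun s => (s, w)) (by fun_prop) ?_
      intro s hs
      rw [mem_bidisc]
      exact ⟨by simpa using hs, hw.trans hr1⟩) hr1 hz
    have e2 : ∀ x, f (u x, w) = (2 * Real.pi : ℂ)⁻¹ * ∫ y in Icc (0 : ℝ) (2 * Real.pi),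
        (1 - w / u y)⁻¹ * f (u x, u y) := fun x =>
      cauchy1 (g := fun s => f (u x, s)) (r := r) (z := w) (by
        refine hf.comp (f := fun s => (u x, s)) (by fun_prop) ?_
        intro s hs
        rw [mem_bidisc]
        exact ⟨by simpa [hun] using hr1, by simpa using hs⟩) hr1 hw
    rw [Measure.volume_eq_prod, setIntegral_prod]
    · simp only [hut]
      change f (z, w) = _ * ∫ x in Icc (0 : ℝ) (2 * Real.pi), (1 - z / u x)⁻¹ * f (u x, w) at e1
      rw [e1]
      simp_rw [e2]
      have : ∀ x, (1 - z / u x)⁻¹ * ((2 * Real.pi : ℂ)⁻¹ * ∫ y in Icc (0 : ℝ) (2 * Real.pi),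
          (1 - w / u y)⁻¹ * f (u x, u y)) = (2 * Real.pi : ℂ)⁻¹ *
          ∫ y in Icc (0 : ℝ) (2 * Real.pi), (1 - z / u x)⁻¹ * (1 - w / u y)⁻¹ * f (u x, u y) := by
        intro x
        simp_rw [mul_assoc]
        rw [integral_const_mul]
        ring
      simp_rw [this]
      rw [integral_const_mul, ← mul_assoc]
      congr 1
      rw [← mul_inv]
      ring
    · refine ContinuousOn.integrableOn_compact isCompact_box (Continuous.continuousOn ?_)
      have c1 : Continuous fun p : ℝ × ℝ => (1 - z / u p.1)⁻¹ :=
        (continuous_const.sub (continuous_const.div (huc.comp continuous_fst)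
          fun p => hune _)).inv₀ fun p => hne hz _
      have c2 : Continuous fun p : ℝ × ℝ => (1 - w / u p.2)⁻¹ :=
        (continuous_const.sub (continuous_const.div (huc.comp continuous_snd)
          fun p => hune _)).inv₀ fun p => hne hw _
      exact (c1.mul c2).mul (continuous_comp_torusPt hf hr0.le hr1)
  -- termwise integration
  have hfc := continuous_comp_torusPt hf hr0.le hr1
  obtain ⟨B, hB⟩ : ∃ B, ∀ p, ‖f (torusPt r p)‖ ≤ B := by
    have hK : IsCompact (Metric.closedBall (0 : ℂ) r ×ˢ Metric.closedBall (0 : ℂ) r) :=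
      (isCompact_closedBall _ _).prod (isCompact_closedBall _ _)
    obtain ⟨B, hB⟩ := hK.exists_bound_of_continuousOn (f := f) (hf.continuousOn.mono (by
      rintro p ⟨h1, h2⟩
      rw [mem_bidisc]
      simp at h1 h2
      exact ⟨h1.trans_lt hr1, h2.trans_lt hr1⟩))
    refine ⟨B, fun p => hB _ ?_⟩
    rw [hut]
    constructor <;> simp [hun]
  have hgeo : ∀ {z : ℂ}, ‖z‖ < r → Summable fun n : ℕ => (‖z‖ / r) ^ n := fun h =>
    summable_geometric_of_lt_one (by positivity) (hq1 h)
  have hs : Summable fun k : ℕ × ℕ => (‖z‖ / r) ^ k.1 * (‖w‖ / r) ^ k.2 :=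
    (hgeo hz).mul_of_nonneg (hgeo hw) (fun _ => by positivity) (fun _ => by positivity)
  have h := hasSum_int
    (G := fun k p => (z / u p.1) ^ k.1 * (w / u p.2) ^ k.2 * f (torusPt r p)) (hs.mul_right B)
    (fun k => (((continuous_const.div (huc.comp continuous_fst) fun p => hune _).pow _).mul
      ((continuous_const.div (huc.comp continuous_snd) fun p => hune _).pow _)).mul hfc)
    (fun k p => by
      rw [norm_mul, norm_mul, norm_pow, norm_pow, hq hz, hq hw]
      exact mul_le_mul_of_nonneg_left (hB p) (by positivity))
  have h1 : ∀ p : ℝ × ℝ, (∑' k : ℕ × ℕ, (z / u p.1) ^ k.1 * (w / u p.2) ^ k.2 * f (torusPt r p))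
      = (1 - z / u p.1)⁻¹ * (1 - w / u p.2)⁻¹ * f (torusPt r p) := by
    intro p
    rw [tsum_mul_right, ← tsum_geometric_of_norm_lt_one (ξ := z / u p.1)
      (by rw [hq hz]; exact hq1 hz), ← tsum_geometric_of_norm_lt_one (ξ := w / u p.2)
      (by rw [hq hw]; exact hq1 hw), tsum_mul_tsum_of_summable_norm]
    · simp_rw [norm_pow, hq hz]; exact hgeo hz
    · simp_rw [norm_pow, hq hw]; exact hgeo hw
  simp_rw [h1] at h
  have h2 := h.mul_left (4 * Real.pi ^ 2 : ℂ)⁻¹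
  rw [← hA] at h2
  convert! h2 using 2 with k
  have h3 : ∀ p : ℝ × ℝ, (z / u p.1) ^ k.1 * (w / u p.2) ^ k.2 * f (torusPt r p) =
      (((r : ℂ) ^ (k.1 + k.2))⁻¹ * mono k (z, w)) * (conj (chr k p) * f (torusPt r p)) := by
    intro p
    simp only [mono, chr, hu, map_mul, map_pow, ← conj_exp_inv, mul_pow, inv_pow, pow_add,
      mul_inv, div_eq_mul_inv]
    ring
  simp_rw [h3]
  rw [integral_const_mul, cauchyCoeff]
  ring

lemma sqMean_of_hasSum {f : ℂ × ℂ → ℂ} {a : ℕ × ℕ → ℂ}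
    (h : ∀ p ∈ bidisc, HasSum (fun k => a k * mono k p) (f p)) {t : ℝ} (h0 : 0 ≤ t) (h1 : t < 1) :
    (Summable fun k => ‖a k * (t : ℂ) ^ (k.1 + k.2)‖) ∧
    (∀ p, f (torusPt t p) = ∑' k, a k * (t : ℂ) ^ (k.1 + k.2) * chr k p) := by
  refine ⟨?_, fun p => ?_⟩
  · have := (h _ (torusPt_mem h0 h1 0)).summable.norm
    refine this.congr fun k => ?_
    rw [mono_torusPt, norm_mul, norm_mul, norm_mul, norm_chr, mul_one]
  · rw [← (h _ (torusPt_mem h0 h1 p)).tsum_eq]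
    refine tsum_congr fun k => ?_
    rw [mono_torusPt, mul_assoc]

lemma sqMean_eq {f : ℂ × ℂ → ℂ} {a : ℕ × ℕ → ℂ}
    (h : ∀ p ∈ bidisc, HasSum (fun k => a k * mono k p) (f p)) {t : ℝ} (h0 : 0 ≤ t) (h1 : t < 1) :
    sqMean t f = ∑' k, ‖a k * (t : ℂ) ^ (k.1 + k.2)‖ ^ 2 := by
  obtain ⟨hs, hf⟩ := sqMean_of_hasSum h h0 h1
  rw [sqMean]
  simp_rw [hf]
  rw [parseval hs, inv_mul_cancel_left₀ (by positivity)]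

lemma cauchyCoeff_eq {f : ℂ × ℂ → ℂ} {a : ℕ × ℕ → ℂ}
    (h : ∀ p ∈ bidisc, HasSum (fun k => a k * mono k p) (f p)) {t : ℝ} (h0 : 0 < t) (h1 : t < 1)
    (j : ℕ × ℕ) : cauchyCoeff f t j = a j := by
  obtain ⟨hs, hf⟩ := sqMean_of_hasSum h h0.le h1
  rw [cauchyCoeff]
  simp_rw [hf]
  rw [coeff_int hs]
  have : (t : ℂ) ≠ 0 := by exact_mod_cast h0.ne'
  have : (Real.pi : ℂ) ≠ 0 := by exact_mod_cast Real.pi_ne_zero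
  field_simp

/-- Holomorphic functions on the bidisc are sums of their Taylor series. -/
lemma taylor {f : ℂ × ℂ → ℂ} (hf : DifferentiableOn ℂ f bidisc) {p : ℂ × ℂ} (hp : p ∈ bidisc) :
    HasSum (fun k => cauchyCoeff f (1 / 2) k * mono k p) (f p) := by
  rw [mem_bidisc] at hp
  obtain ⟨r, hr, hr1⟩ := exists_between (max_lt (max_lt hp.1 hp.2) (show (1 / 2 : ℝ) < 1 by norm_num))
  simp only [max_lt_iff] at hr
  have key : ∀ j, cauchyCoeff f (1 / 2) j = cauchyCoeff f r j := by
    intro j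
    have hs : Summable fun k => ‖cauchyCoeff f r k * ((1 / 2 : ℝ) : ℂ) ^ (k.1 + k.2)‖ := by
      have := (cauchy2 hf hr1 (q := torusPt (1 / 2) 0)
        (by simpa [torusPt] using hr.2) (by simpa [torusPt] using hr.2)).summable.norm
      refine this.congr fun k => ?_
      rw [mono_torusPt, norm_mul, norm_mul, norm_mul, norm_chr, mul_one]
    have he : ∀ p, f (torusPt (1 / 2) p) =
        ∑' k, cauchyCoeff f r k * ((1 / 2 : ℝ) : ℂ) ^ (k.1 + k.2) * chr k p := by
      intro p
      rw [← (cauchy2 hf hr1 (q := torusPt (1 / 2) p)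
        (by simpa [torusPt, Complex.norm_exp_ofReal_mul_I] using hr.2)
        (by simpa [torusPt, Complex.norm_exp_ofReal_mul_I] using hr.2)).tsum_eq]
      refine tsum_congr fun k => ?_
      rw [mono_torusPt, mul_assoc]
    rw [cauchyCoeff]
    simp_rw [he]
    rw [coeff_int hs]
    have : (Real.pi : ℂ) ≠ 0 := by exact_mod_cast Real.pi_ne_zero
    field_simp
  simp_rw [key]
  exact cauchy2 hf hr1 hr.1.1 hr.1.2

lemma summable_bdd {a : ℕ × ℕ → ℂ} {C : ℝ} (hC : ∀ k, ‖a k‖ ≤ C) {p : ℂ × ℂ} (hp : p ∈ bidisc) :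
    Summable fun k => a k * mono k p := by
  rw [mem_bidisc] at hp
  refine Summable.of_norm_bounded (g := fun k => C * (‖p.1‖ ^ k.1 * ‖p.2‖ ^ k.2))
    (Summable.mul_left _ ((summable_geometric_of_lt_one (norm_nonneg _) hp.1).mul_of_nonneg
      (summable_geometric_of_lt_one (norm_nonneg _) hp.2) (fun _ => by positivity)
      (fun _ => by positivity))) fun k => ?_
  rw [mono, norm_mul, norm_mul, norm_pow, norm_pow]
  exact mul_le_mul_of_nonneg_right (hC k) (by positivity)

/-- The derivative of a monomial. -/
def dmono (k : ℕ × ℕ) (q : ℂ × ℂ) : ℂ × ℂ →L[ℂ] ℂ :=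
  (q.1 ^ k.1 * ((k.2 : ℂ) * q.2 ^ (k.2 - 1))) • ContinuousLinearMap.snd ℂ ℂ ℂ +
    (q.2 ^ k.2 * ((k.1 : ℂ) * q.1 ^ (k.1 - 1))) • ContinuousLinearMap.fst ℂ ℂ ℂ

lemma hasFDerivAt_mono (k : ℕ × ℕ) (q : ℂ × ℂ) : HasFDerivAt (mono k) (dmono k q) q := by
  have h1 : HasFDerivAt (fun q : ℂ × ℂ => q.1 ^ k.1)
      (((k.1 : ℂ) * q.1 ^ (k.1 - 1)) • ContinuousLinearMap.fst ℂ ℂ ℂ) q :=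
    (hasDerivAt_pow k.1 q.1).comp_hasFDerivAt q hasFDerivAt_fst
  have h2 : HasFDerivAt (fun q : ℂ × ℂ => q.2 ^ k.2)
      (((k.2 : ℂ) * q.2 ^ (k.2 - 1)) • ContinuousLinearMap.snd ℂ ℂ ℂ) q :=
    (hasDerivAt_pow k.2 q.2).comp_hasFDerivAt q hasFDerivAt_snd
  have h3 := h1.mul h2
  rw [smul_smul, smul_smul] at h3
  exact h3

lemma norm_dmono_le (k : ℕ × ℕ) {q : ℂ × ℂ} {r : ℝ} (h1 : ‖q.1‖ ≤ r) (h2 : ‖q.2‖ ≤ r) :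
    ‖dmono k q‖ ≤ r ^ k.1 * (k.2 * r ^ (k.2 - 1)) + (k.1 * r ^ (k.1 - 1)) * r ^ k.2 := by
  have hr : 0 ≤ r := (norm_nonneg _).trans h1
  have hf := ContinuousLinearMap.norm_fst_le ℂ ℂ ℂ
  have hg := ContinuousLinearMap.norm_snd_le ℂ ℂ ℂ
  refine (norm_add_le _ _).trans (add_le_add ?_ ?_)
  · rw [norm_smul, norm_mul, norm_mul, norm_pow, norm_pow, Complex.norm_natCast]
    refine (mul_le_of_le_one_right (by positivity) hg).trans ?_
    gcongr
  · rw [norm_smul, norm_mul, norm_mul, norm_pow, norm_pow, Complex.norm_natCast,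
      mul_comm (_ * _) (r ^ k.2)]
    refine (mul_le_of_le_one_right (by positivity) hf).trans ?_
    gcongr

lemma summable_deriv {r : ℝ} (hr0 : 0 ≤ r) (hr1 : r < 1) :
    Summable fun k : ℕ × ℕ => r ^ k.1 * ((k.2 : ℝ) * r ^ (k.2 - 1)) +
      ((k.1 : ℝ) * r ^ (k.1 - 1)) * r ^ k.2 := by
  have hgeo : Summable fun n : ℕ => r ^ n := summable_geometric_of_lt_one hr0 hr1
  have hder : Summable fun n : ℕ => (n : ℝ) * r ^ (n - 1) := by
    rw [← summable_nat_add_iff 1]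
    have h1 := summable_pow_mul_geometric_of_norm_lt_one 1 (r := r)
      (by rwa [Real.norm_of_nonneg hr0])
    refine (h1.add hgeo).congr fun n => ?_
    push_cast
    simp
    ring
  have hg0 : 0 ≤ fun n : ℕ => r ^ n := fun n => pow_nonneg hr0 n
  have hd0 : 0 ≤ fun n : ℕ => (n : ℝ) * r ^ (n - 1) := fun n =>
    mul_nonneg n.cast_nonneg (pow_nonneg hr0 _)
  exact (hgeo.mul_of_nonneg hder hg0 hd0).add (hder.mul_of_nonneg hgeo hd0 hg0)

lemma differentiableOn_series {a : ℕ × ℕ → ℂ} {C : ℝ} (hC : ∀ k, ‖a k‖ ≤ C) :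
    DifferentiableOn ℂ (fun p => ∑' k, a k * mono k p) bidisc := by
  intro p hp
  refine DifferentiableAt.differentiableWithinAt ?_
  have hp' := mem_bidisc.1 hp
  obtain ⟨r, hr, hr1⟩ := exists_between (max_lt hp'.1 hp'.2)
  rw [max_lt_iff] at hr
  have hr0 : 0 < r := (norm_nonneg _).trans_lt hr.1
  have hps : p ∈ Metric.ball (0 : ℂ) r ×ˢ Metric.ball (0 : ℂ) r := by simp [hr]
  have hf : ∀ k q, q ∈ Metric.ball (0 : ℂ) r ×ˢ Metric.ball (0 : ℂ) r →
      HasFDerivAt (fun q => a k * mono k q) (a k • dmono k q) q :=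
    fun k q _ => (hasFDerivAt_mono k q).const_mul (a k)
  have hb : ∀ k q, q ∈ Metric.ball (0 : ℂ) r ×ˢ Metric.ball (0 : ℂ) r →
      ‖a k • dmono k q‖ ≤ C * (r ^ k.1 * (k.2 * r ^ (k.2 - 1)) +
        (k.1 * r ^ (k.1 - 1)) * r ^ k.2) := by
    intro k q hq
    simp only [mem_prod, Metric.mem_ball, dist_zero_right] at hq
    rw [norm_smul]
    exact mul_le_mul (hC k) (norm_dmono_le k hq.1.le hq.2.le) (norm_nonneg _)
      ((norm_nonneg _).trans (hC k))
  exact (hasFDerivAt_tsum_of_isPreconnected ((summable_deriv hr0.le hr1).mul_left C)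
    (Metric.isOpen_ball.prod Metric.isOpen_ball)
    ((convex_ball (0 : ℂ) r).prod (convex_ball (0 : ℂ) r)).isPreconnected hf hb hps
    (summable_bdd hC hp) hps).differentiableAt

end HardyAux

/-- The Hardy space `H²(𝔻²)` as a space of functions: holomorphic functions on the bidisc
(extended by zero outside of it) whose square means over the tori of radius `t < 1` are bounded. -/
def hardySubmodule : Submodule ℂ (ℂ × ℂ → ℂ) where
  carrier := {f | DifferentiableOn ℂ f bidisc ∧ (∀ p, p ∉ bidisc → f p = 0) ∧
    ∃ C : ℝ, ∀ t : ℝ, 0 ≤ t → t < 1 → sqMean t f ≤ C}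
  zero_mem' := ⟨differentiableOn_const 0, fun _ _ => rfl, 0, fun t _ _ => by simp [sqMean]⟩
  add_mem' := by
    rintro f g ⟨hf, hf0, C, hC⟩ ⟨hg, hg0, D, hD⟩
    refine ⟨hf.add hg, fun p hp => by simp [hf0 p hp, hg0 p hp], 2 * C + 2 * D, fun t h0 h1 => ?_⟩
    refine le_trans ?_ (add_le_add (mul_le_mul_of_nonneg_left (hC t h0 h1) zero_le_two)
      (mul_le_mul_of_nonneg_left (hD t h0 h1) zero_le_two))
    have cf := HardyAux.continuous_comp_torusPt hf h0 h1
    have cg := HardyAux.continuous_comp_torusPt hg h0 h1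
    have hi : ∀ {G : ℝ × ℝ → ℝ}, Continuous G → IntegrableOn G argBox := fun hG =>
      hG.continuousOn.integrableOn_compact HardyAux.isCompact_box
    have i1 : IntegrableOn (fun p => ‖f (torusPt t p)‖ ^ 2) argBox := hi (cf.norm.pow 2)
    have i2 : IntegrableOn (fun p => ‖g (torusPt t p)‖ ^ 2) argBox := hi (cg.norm.pow 2)
    have i3 : IntegrableOn (fun p => ‖f (torusPt t p) + g (torusPt t p)‖ ^ 2) argBox :=
      hi ((cf.add cg).norm.pow 2)
    have key : (∫ p in argBox, ‖f (torusPt t p) + g (torusPt t p)‖ ^ 2) ≤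
        2 * (∫ p in argBox, ‖f (torusPt t p)‖ ^ 2) + 2 * ∫ p in argBox, ‖g (torusPt t p)‖ ^ 2 := by
      rw [← integral_const_mul, ← integral_const_mul,
        ← integral_add (i1.const_mul 2) (i2.const_mul 2)]
      refine integral_mono i3 ((i1.const_mul 2).add (i2.const_mul 2)) fun p => ?_
      have := norm_add_le (f (torusPt t p)) (g (torusPt t p))
      nlinarith [norm_nonneg (f (torusPt t p) + g (torusPt t p)),
        sq_nonneg (‖f (torusPt t p)‖ - ‖g (torusPt t p)‖)]
    simp only [sqMean, Pi.add_apply]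
    calc _ ≤ (4 * Real.pi ^ 2)⁻¹ * _ := mul_le_mul_of_nonneg_left key (by positivity)
      _ = _ := by ring
  smul_mem' := by
    rintro c f ⟨hf, hf0, C, hC⟩
    refine ⟨hf.const_smul c, fun p hp => by simp [hf0 p hp], ‖c‖ ^ 2 * C, fun t h0 h1 => ?_⟩
    refine le_trans (le_of_eq ?_) (mul_le_mul_of_nonneg_left (hC t h0 h1) (sq_nonneg ‖c‖))
    simp only [sqMean, Pi.smul_apply, smul_eq_mul, norm_mul, mul_pow]
    rw [integral_const_mul]
    ring

/-- The Hardy space `H²(𝔻²)`. -/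
def HardyBidisc : Type := hardySubmodule

namespace HardyBidisc

instance : AddCommGroup HardyBidisc := inferInstanceAs (AddCommGroup hardySubmodule)

instance : Module ℂ HardyBidisc := inferInstanceAs (Module ℂ hardySubmodule)

instance : CoeFun HardyBidisc fun _ => ℂ × ℂ → ℂ := ⟨fun f => f.1⟩

lemma ext_bidisc {f g : HardyBidisc} (h : ∀ p ∈ bidisc, f p = g p) : f = g := by
  refine Subtype.ext (funext fun p => ?_)
  by_cases hp : p ∈ bidisc
  · exact h p hp
  · rw [f.2.2.1 p hp, g.2.2.1 p hp]

/-- The Taylor coefficient `a_{m,n}` of `f = ∑ a_{m,n} z^m w^n`, for `k = (m, n)`. -/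
def coeff (f : HardyBidisc) (k : ℕ × ℕ) : ℂ := HardyAux.cauchyCoeff f (1 / 2) k

lemma hasSum (f : HardyBidisc) {p : ℂ × ℂ} (hp : p ∈ bidisc) :
    HasSum (fun k : ℕ × ℕ => coeff f k * (p.1 ^ k.1 * p.2 ^ k.2)) (f p) :=
  HardyAux.taylor f.2.1 hp

lemma coeff_unique (f : HardyBidisc) {a : ℕ × ℕ → ℂ}
    (h : ∀ p ∈ bidisc, HasSum (fun k => a k * (p.1 ^ k.1 * p.2 ^ k.2)) (f p)) : coeff f = a :=
  funext fun k => HardyAux.cauchyCoeff_eq h (by norm_num) (by norm_num) k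

lemma sqMean_eq (f : HardyBidisc) {t : ℝ} (h0 : 0 ≤ t) (h1 : t < 1) :
    HasSum (fun k => ‖coeff f k * (t : ℂ) ^ (k.1 + k.2)‖ ^ 2) (sqMean t f) := by
  have h : ∀ p ∈ bidisc, HasSum (fun k => coeff f k * HardyAux.mono k p) (f p) :=
    fun p hp => f.hasSum hp
  rw [HardyAux.sqMean_eq h h0 h1]
  have hs := (HardyAux.sqMean_of_hasSum h h0 h1).1
  refine Summable.hasSum ?_
  refine (hs.mul_of_nonneg hs (fun _ => norm_nonneg _) fun _ => norm_nonneg _).comp_injective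
    (i := fun k => (k, k)) (fun a b h => (Prod.ext_iff.1 h).1) |>.congr fun k => ?_
  simp [sq]

lemma sum_sq_le (f : HardyBidisc) {C : ℝ} (hC : ∀ t : ℝ, 0 ≤ t → t < 1 → sqMean t f ≤ C)
    (s : Finset (ℕ × ℕ)) : ∑ k ∈ s, ‖coeff f k‖ ^ 2 ≤ C := by
  have hc : Continuous fun t : ℝ => ∑ k ∈ s, ‖coeff f k * (t : ℂ) ^ (k.1 + k.2)‖ ^ 2 := by
    fun_prop
  have ht : Tendsto (fun t : ℝ => ∑ k ∈ s, ‖coeff f k * (t : ℂ) ^ (k.1 + k.2)‖ ^ 2) (𝓝[<] 1)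
      (𝓝 (∑ k ∈ s, ‖coeff f k‖ ^ 2)) := by
    have := (hc.tendsto 1).mono_left (nhdsWithin_le_nhds (s := Iio 1))
    simpa using this
  refine le_of_tendsto ht ?_
  filter_upwards [Ioo_mem_nhdsLT (show (0 : ℝ) < 1 by norm_num)] with t ht
  exact (sum_le_hasSum s (fun _ _ => by positivity) (f.sqMean_eq ht.1.le ht.2)).trans
    (hC t ht.1.le ht.2)

lemma summable_sq (f : HardyBidisc) : Summable fun k => ‖coeff f k‖ ^ 2 := by
  obtain ⟨C, hC⟩ := f.2.2.2
  exact summable_of_sum_le (fun _ => by positivity) (f.sum_sq_le hC)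

/-- The Taylor coefficients of a function in `H²(𝔻²)`, as an element of `ℓ²(ℕ × ℕ)`. -/
def coeffs : HardyBidisc →ₗ[ℂ] lp (fun _ : ℕ × ℕ => ℂ) 2 where
  toFun f := ⟨coeff f, memℓp_gen (by simpa using f.summable_sq)⟩
  map_add' f g := Subtype.ext <| coeff_unique (f + g) fun p hp => by
    have h := (f.hasSum hp).add (g.hasSum hp)
    simp_rw [← add_mul] at h
    exact h
  map_smul' c f := Subtype.ext <| coeff_unique (c • f) fun p hp => by
    simpa [mul_assoc] using! (f.hasSum hp).mul_left c

lemma coeffs_injective : Function.Injective coeffs := fun f g h => ext_bidisc fun p hp => by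
  have h' : coeff f = coeff g := congrArg Subtype.val h
  exact (f.hasSum hp).unique (h' ▸ g.hasSum hp)

lemma coeffs_surjective : Function.Surjective coeffs := by
  intro a
  have hb : ∀ k, ‖a k‖ ≤ ‖a‖ := fun k => lp.norm_apply_le_norm two_ne_zero a k
  have hsq : Summable fun k => ‖a k‖ ^ 2 := by
    simpa using (lp.memℓp a).summable (by norm_num)
  set F : ℂ × ℂ → ℂ := bidisc.indicator fun p => ∑' k, a k * HardyAux.mono k p with hF
  have hs : ∀ p ∈ bidisc, HasSum (fun k => a k * HardyAux.mono k p) (F p) := fun p hp => by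
    rw [hF, indicator_of_mem hp]
    exact (HardyAux.summable_bdd hb hp).hasSum
  refine ⟨⟨F, ?_, fun p hp => indicator_of_notMem hp _, ∑' k, ‖a k‖ ^ 2, fun t h0 h1 => ?_⟩, ?_⟩
  · exact (HardyAux.differentiableOn_series hb).congr fun p hp => indicator_of_mem hp _
  · rw [HardyAux.sqMean_eq hs h0 h1]
    have hle : ∀ k : ℕ × ℕ, ‖a k * (t : ℂ) ^ (k.1 + k.2)‖ ^ 2 ≤ ‖a k‖ ^ 2 := fun k => by
      refine pow_le_pow_left₀ (norm_nonneg _) ?_ 2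
      rw [norm_mul, norm_pow, Complex.norm_real, Real.norm_of_nonneg h0]
      exact mul_le_of_le_one_right (norm_nonneg _) (pow_le_one₀ h0 h1.le)
    exact (hsq.of_nonneg_of_le (fun _ => by positivity) hle).tsum_le_tsum hle hsq
  · exact Subtype.ext (coeff_unique _ hs)

/-- The norm of `H²(𝔻²)` is the `ℓ²` norm of the Taylor coefficients. -/
instance : NormedAddCommGroup HardyBidisc :=
  NormedAddCommGroup.induced HardyBidisc (lp (fun _ : ℕ × ℕ => ℂ) 2) coeffs coeffs_injective

lemma norm_coeffs (f : HardyBidisc) : ‖coeffs f‖ = ‖f‖ := rfl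

/-- The inner product `∑ conj (a_{m,n}) b_{m,n}` of `H²(𝔻²)`. -/
instance : InnerProductSpace ℂ HardyBidisc where
  norm_smul_le c f := by
    rw [← norm_coeffs, ← norm_coeffs, map_smul, norm_smul]
  inner f g := inner ℂ (coeffs f) (coeffs g)
  norm_sq_eq_re_inner f := by
    rw [← norm_coeffs]; exact InnerProductSpace.norm_sq_eq_re_inner (𝕜 := ℂ) (coeffs f)
  conj_inner_symm f g := inner_conj_symm (coeffs f) (coeffs g)
  add_left f g h := by rw [map_add, inner_add_left]
  smul_left f g c := by rw [map_smul, inner_smul_left]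

/-- `H²(𝔻²)` is isometrically isomorphic to `ℓ²(ℕ × ℕ)`. -/
def coeffsEquiv : HardyBidisc ≃ₗᵢ[ℂ] lp (fun _ : ℕ × ℕ => ℂ) 2 where
  toLinearEquiv := LinearEquiv.ofBijective coeffs ⟨coeffs_injective, coeffs_surjective⟩
  norm_map' := norm_coeffs

instance : CompleteSpace HardyBidisc :=
  coeffsEquiv.toIsometryEquiv.completeSpace

/-- The square of the norm is the supremum of the square means, as usual for Hardy spaces. -/
lemma isLUB_norm_sq (f : HardyBidisc) : IsLUB ((fun t => sqMean t f) '' Ico 0 1) (‖f‖ ^ 2) := by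
  have hn : HasSum (fun k => ‖coeff f k‖ ^ 2) (‖f‖ ^ 2) := by
    have := lp.hasSum_norm (p := 2) (by norm_num) (coeffs f)
    simpa [norm_coeffs] using! this
  constructor
  · rintro _ ⟨t, ⟨h0, h1⟩, rfl⟩
    refine hasSum_le (fun k => ?_) (f.sqMean_eq h0 h1) hn
    refine pow_le_pow_left₀ (norm_nonneg _) ?_ 2
    rw [norm_mul, norm_pow, Complex.norm_real, Real.norm_of_nonneg h0]
    exact mul_le_of_le_one_right (norm_nonneg _) (pow_le_one₀ h0 h1.le)
  · intro C hC
    refine hasSum_le_of_sum_le hn (f.sum_sq_le fun t h0 h1 => hC ⟨t, ⟨h0, h1⟩, rfl⟩)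

lemma sqMean_mul_le {φ f : ℂ × ℂ → ℂ} (hφ : DifferentiableOn ℂ φ bidisc)
    (hφ1 : ∀ p ∈ bidisc, ‖φ p‖ ≤ 1) (hf : DifferentiableOn ℂ f bidisc) {t : ℝ} (h0 : 0 ≤ t)
    (h1 : t < 1) : sqMean t (fun p => φ p * f p) ≤ sqMean t f := by
  have hi : ∀ {G : ℝ × ℝ → ℂ}, Continuous G → IntegrableOn (fun p => ‖G p‖ ^ 2) argBox :=
    fun hG => (hG.norm.pow 2).continuousOn.integrableOn_compact HardyAux.isCompact_box
  have c1 := HardyAux.continuous_comp_torusPt hφ h0 h1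
  have c2 := HardyAux.continuous_comp_torusPt hf h0 h1
  refine mul_le_mul_of_nonneg_left ?_ (by positivity)
  refine integral_mono (hi (c1.mul c2)) (hi c2) fun p => ?_
  refine pow_le_pow_left₀ (norm_nonneg _) ?_ 2
  rw [norm_mul]
  exact mul_le_of_le_one_left (norm_nonneg _) (hφ1 _ (HardyAux.torusPt_mem h0 h1 p))

/-- Multiplication on `H²(𝔻²)` by a holomorphic function bounded by one. -/
def mulOp (φ : ℂ × ℂ → ℂ) (hφ : DifferentiableOn ℂ φ bidisc) (hφ1 : ∀ p ∈ bidisc, ‖φ p‖ ≤ 1) :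
    HardyBidisc →L[ℂ] HardyBidisc :=
  LinearMap.mkContinuous
    { toFun := fun f => ⟨fun p => φ p * f p, hφ.mul f.2.1, fun p hp => by simp [f.2.2.1 p hp],
        ‖f‖ ^ 2, fun t h0 h1 => (sqMean_mul_le hφ hφ1 f.2.1 h0 h1).trans
          (f.isLUB_norm_sq.1 ⟨t, ⟨h0, h1⟩, rfl⟩)⟩
      map_add' := fun f g => Subtype.ext <| funext fun p => mul_add _ (f p) (g p)
      map_smul' := fun c f => Subtype.ext <| funext fun p => mul_left_comm (φ p) c (f p) } 1
    fun f => by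
      rw [one_mul]
      refine le_of_sq_le_sq ?_ (norm_nonneg _)
      refine (isLUB_norm_sq _).2 ?_
      rintro _ ⟨t, ⟨h0, h1⟩, rfl⟩
      exact (sqMean_mul_le hφ hφ1 f.2.1 h0 h1).trans (f.isLUB_norm_sq.1 ⟨t, ⟨h0, h1⟩, rfl⟩)

/-- The operator `M₁` of multiplication by the first coordinate `z`. -/
def M₁ : HardyBidisc →L[ℂ] HardyBidisc :=
  mulOp (fun p => p.1) differentiableOn_fst fun _ hp => (HardyAux.mem_bidisc.1 hp).1.le

/-- The operator `M₂` of multiplication by the second coordinate `w`. -/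
def M₂ : HardyBidisc →L[ℂ] HardyBidisc :=
  mulOp (fun p => p.2) differentiableOn_snd fun _ hp => (HardyAux.mem_bidisc.1 hp).2.le

/-- A quotient module of `H²(𝔻²)`: a closed subspace invariant under `M₁*` and `M₂*`. -/
def IsQuotientModule (Q : Submodule ℂ HardyBidisc) : Prop :=
  IsClosed (Q : Set HardyBidisc) ∧
    ∀ f ∈ Q, ContinuousLinearMap.adjoint M₁ f ∈ Q ∧ ContinuousLinearMap.adjoint M₂ f ∈ Q

/-- The compression `P_Q T|_Q` of an operator `T` to a closed subspace `Q`. -/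
def compression (Q : Submodule ℂ HardyBidisc) [CompleteSpace Q]
    (T : HardyBidisc →L[ℂ] HardyBidisc) : Q →L[ℂ] Q :=
  Q.orthogonalProjectionOnto ∘L T ∘L Q.subtypeL

/-- A quotient module `Q` of `H²(𝔻²)` is `φ`-doubly commuting if the compressions
`Q₁ = P_Q M₁|_Q` and `Q₂ = P_Q M₂|_Q` satisfy `Q₁ Q₂ Q₂* = Q₂* Q₁ Q₂`. -/
def IsPhiDoublyCommuting (Q : Submodule ℂ HardyBidisc) [CompleteSpace Q] : Prop :=
  IsQuotientModule Q ∧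
    compression Q M₁ ∘L compression Q M₂ ∘L ContinuousLinearMap.adjoint (compression Q M₂) =
      ContinuousLinearMap.adjoint (compression Q M₂) ∘L compression Q M₁ ∘L compression Q M₂

/-- The subspace `θ₁(z)θ₂(w)H²(𝔻²)` of `H²(𝔻²)`. -/
def productSubmodule (θ₁ θ₂ : ℂ → ℂ) : Submodule ℂ HardyBidisc where
  carrier := {f | ∃ g : HardyBidisc, ∀ p ∈ bidisc, f p = θ₁ p.1 * θ₂ p.2 * g p}
  zero_mem' := ⟨0, fun p _ => (mul_zero _).symm⟩
  add_mem' := by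
    rintro f f' ⟨g, hg⟩ ⟨g', hg'⟩
    refine ⟨g + g', fun p hp => ?_⟩
    change f p + f' p = θ₁ p.1 * θ₂ p.2 * (g p + g' p)
    rw [hg p hp, hg' p hp, mul_add]
  smul_mem' := by
    rintro c f ⟨g, hg⟩
    refine ⟨c • g, fun p hp => ?_⟩
    change c * f p = θ₁ p.1 * θ₂ p.2 * (c * g p)
    rw [hg p hp, mul_left_comm]

end HardyBidisc

/-- Inner functions on the unit disc: bounded holomorphic functions on `𝔻` whose radial limits
exist and are unimodular at almost every point of the unit circle. Values outside of `𝔻` are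
irrelevant. -/
structure IsInner (θ : ℂ → ℂ) : Prop where
  holo : DifferentiableOn ℂ θ (Metric.ball 0 1)
  bdd : ∃ C : ℝ, ∀ z ∈ Metric.ball (0 : ℂ) 1, ‖θ z‖ ≤ C
  radial : ∀ᵐ α : ℝ, ∃ ζ : ℂ, ‖ζ‖ = 1 ∧
    Tendsto (fun r : ℝ => θ (r * Complex.exp (α * Complex.I))) (𝓝[<] 1) (𝓝 ζ)

end

/-! Write V for multiplication by θ₁(z)θ₂(w). Inner functions act isometrically on H²
(`norm_mulOp`), so Q is the kernel of V* and P_Q = 1 - VV*. Since Q is invariant under M₁* and M₂*,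
the commutation relation becomes P_Q M₁M₂M₂* f = M₂* P_Q M₁M₂ f for f in Q
(`IsPhiDoublyCommuting.eq`). Both sides are computable because M_i* is a backward shift, and θ*
sends 1 to conj θ(0) and the coordinate x to conj θ(0) x + conj θ'(0).

Necessity uses two test vectors. Put a = θ₂(0) and d = θ₂'(0). The vector θ₁(z)(1 - ā θ₂(w)) yields
(1 - |a|²) w (1 - ā θ₂) = d̄ (θ₂ - a) (`IsPhiDoublyCommuting.snd_eq`). Unless θ₂ is constant,
comparing derivatives at 0 gives |d| = 1 - |a|², and solving for θ₂ gives a Blaschke factor. The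
vector 1 - conj θ₁(0) θ₁(z) gives an identity in z and w (`IsPhiDoublyCommuting.fst_eq`); freezing w
leaves z(1 - conj θ₁(0) θ₁) = C θ₁, so θ₁ is constant or a unimodular multiple of z. If θ₁ = c₁z,
the same identity reads w(1 - ā θ₂) = d̄ (θ₂ - a); against the first equation this gives |a|² w (1 -
ā θ₂) = 0, so θ₂ is constant or a = 0, and in the latter case θ₂ is a multiple of w.

Sufficiency is degenerate in every case: Q = 0, or Q₂* is scalar, or Q₁ = 0, or Q₁Q₂ = 0. -/

/-! ### Boundary behaviour of inner functions and the bound by one. -/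

lemma IsInner.tendsto_norm {θ : ℂ → ℂ} (h : IsInner θ) : ∀ᵐ α : ℝ,
    Tendsto (fun r : ℝ => ‖θ (r * Complex.exp (α * Complex.I))‖) (𝓝[<] 1) (𝓝 1) := by
  filter_upwards [h.radial] with α ⟨ζ, hζ, ht⟩
  exact hζ ▸ ht.norm

lemma IsInner.exists_tendsto_norm {θ : ℂ → ℂ} (h : IsInner θ) : ∃ ξ : ℂ, ‖ξ‖ = 1 ∧
    Tendsto (fun r : ℝ => ‖θ (r * ξ)‖) (𝓝[<] 1) (𝓝 1) := by
  obtain ⟨α, hα⟩ := h.tendsto_norm.exists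
  exact ⟨_, Complex.norm_exp_ofReal_mul_I α, hα⟩

lemma ofReal_mul_mem_ball {r : ℝ} (h0 : 0 ≤ r) (h1 : r < 1) {ξ : ℂ} (hξ : ‖ξ‖ = 1) :
    (r * ξ : ℂ) ∈ Metric.ball (0 : ℂ) 1 := by
  simpa [hξ, abs_of_nonneg h0] using h1

lemma eventually_mem_Ioo {s : ℝ} (hs : s < 1) : ∀ᶠ r : ℝ in 𝓝[<] 1, r ∈ Ioo s 1 :=
  Ioo_mem_nhdsLT hs

/-- Near the end of a good radius |θ| is close to 1. Avoiding the origin as well allows the factor z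
θ(z) to be cancelled from an identity. -/
lemma IsInner.exists_ne_zero {θ : ℂ → ℂ} (h : IsInner θ) :
    ∃ z ∈ Metric.ball (0 : ℂ) 1, z ≠ 0 ∧ θ z ≠ 0 := by
  obtain ⟨ξ, hξ, ht⟩ := h.exists_tendsto_norm
  have h1 := ht.eventually (lt_mem_nhds (show (0 : ℝ) < 1 by norm_num))
  obtain ⟨r, hr, hr'⟩ := (h1.and (eventually_mem_Ioo (show (0 : ℝ) < 1 by norm_num))).exists
  refine ⟨r * ξ, ofReal_mul_mem_ball hr'.1.le hr'.2 hξ, ?_, norm_pos_iff.1 hr⟩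
  refine mul_ne_zero (by exact_mod_cast hr'.1.ne') fun h => ?_
  simp [h] at hξ

lemma IsInner.norm_const {θ : ℂ → ℂ} (h : IsInner θ) {c : ℂ}
    (hc : ∀ z ∈ Metric.ball (0 : ℂ) 1, θ z = c) : ‖c‖ = 1 := by
  obtain ⟨ξ, hξ, ht⟩ := h.exists_tendsto_norm
  refine tendsto_nhds_unique (tendsto_const_nhds.congr' ?_) ht
  filter_upwards [eventually_mem_Ioo (show (0 : ℝ) < 1 by norm_num)] with r hr
  rw [hc _ (ofReal_mul_mem_ball hr.1.le hr.2 hξ)]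

lemma IsInner.norm_linear {θ : ℂ → ℂ} (h : IsInner θ) {c : ℂ}
    (hc : ∀ z ∈ Metric.ball (0 : ℂ) 1, θ z = c * z) : ‖c‖ = 1 := by
  obtain ⟨ξ, hξ, ht⟩ := h.exists_tendsto_norm
  have h1 : Tendsto (fun r : ℝ => ‖c * (r * ξ)‖) (𝓝[<] 1) (𝓝 ‖c * ((1 : ℝ) * ξ)‖) :=
    ((by fun_prop : Continuous fun r : ℝ => ‖c * (r * ξ)‖).tendsto 1).mono_left
      nhdsWithin_le_nhds
  have h2 : ‖c * ((1 : ℝ) * ξ)‖ = ‖c‖ := by simp [hξ]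
  rw [← h2]
  refine tendsto_nhds_unique (h1.congr' ?_) ht
  filter_upwards [eventually_mem_Ioo (show (0 : ℝ) < 1 by norm_num)] with r hr
  rw [hc _ (ofReal_mul_mem_ball hr.1.le hr.2 hξ)]

lemma IsInner.continuous_circle {θ : ℂ → ℂ} (h : IsInner θ) {r : ℝ} (h0 : 0 ≤ r) (h1 : r < 1) :
    Continuous fun x : ℝ => θ (r * Complex.exp (x * Complex.I)) :=
  h.holo.continuousOn.comp_continuous (by fun_prop) fun x =>
    ofReal_mul_mem_ball h0 h1 (Complex.norm_exp_ofReal_mul_I x)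

/-- Cauchy's formula for θⁿ on the circle of radius r has kernel at most (1 - |z|/r)⁻¹, and as r → 1
the mean of |θ|ⁿ tends to 1 by dominated convergence. The bound does not depend on n, which forces
|θ(z)| ≤ 1. -/
lemma IsInner.norm_pow_le {θ : ℂ → ℂ} (h : IsInner θ) {z : ℂ} (hz : ‖z‖ < 1) (n : ℕ) :
    ‖θ z‖ ^ n ≤ (1 - ‖z‖)⁻¹ := by
  obtain ⟨C, hC⟩ := h.bdd
  have h2π : (0 : ℝ) < 2 * Real.pi := by positivity
  have hlim : Tendsto (fun r : ℝ => ∫ x in Icc (0 : ℝ) (2 * Real.pi),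
      ‖θ (r * Complex.exp (x * Complex.I))‖ ^ n) (𝓝[<] 1)
      (𝓝 (∫ x in Icc (0 : ℝ) (2 * Real.pi), (1 : ℝ))) := by
    refine tendsto_integral_filter_of_dominated_convergence (fun _ => C ^ n) ?_ ?_ ?_ ?_
    · filter_upwards [eventually_mem_Ioo zero_lt_one] with r hr
      exact ((h.continuous_circle hr.1.le hr.2).norm.pow n).aestronglyMeasurable
    · filter_upwards [eventually_mem_Ioo zero_lt_one] with r hr
      refine Eventually.of_forall fun x => ?_
      rw [norm_pow, norm_norm]
      exact pow_le_pow_left₀ (norm_nonneg _)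
        (hC _ (ofReal_mul_mem_ball hr.1.le hr.2 (Complex.norm_exp_ofReal_mul_I x))) n
    · exact integrable_const _
    · filter_upwards [ae_restrict_of_ae h.tendsto_norm] with x hx
      simpa using hx.pow n
  have hlim1 : Tendsto (fun r : ℝ => (1 - ‖z‖ / r)⁻¹) (𝓝[<] 1) (𝓝 (1 - ‖z‖)⁻¹) := by
    have : Tendsto (fun r : ℝ => (1 - ‖z‖ / r)⁻¹) (𝓝 1) (𝓝 (1 - ‖z‖ / 1)⁻¹) :=
      (tendsto_const_nhds.sub (tendsto_const_nhds.div tendsto_id one_ne_zero)).inv₀ (by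
        simp only [div_one]; linarith)
    simpa using this.mono_left (nhdsWithin_le_nhds (s := Iio 1))
  have hlim2 := ((hlim1.mul hlim).const_mul (2 * Real.pi)⁻¹)
  have he : (2 * Real.pi)⁻¹ * ((1 - ‖z‖)⁻¹ * ∫ x in Icc (0 : ℝ) (2 * Real.pi), (1 : ℝ)) =
      (1 - ‖z‖)⁻¹ := by
    simp [Real.pi_pos.le]
    field_simp
  rw [he] at hlim2
  refine ge_of_tendsto hlim2 ?_
  filter_upwards [eventually_mem_Ioo hz] with r hr
  have hr0 : 0 < r := (norm_nonneg z).trans_lt hr.1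
  have hc := HardyAux.cauchy1 (h.holo.pow n) hr.2 hr.1
  simp only [Pi.pow_apply] at hc
  rw [← norm_pow, hc, norm_mul]
  have : ‖(2 * Real.pi : ℂ)⁻¹‖ = (2 * Real.pi)⁻¹ := by
    simp [abs_of_pos Real.pi_pos]
  rw [this, ← integral_const_mul]
  refine mul_le_mul_of_nonneg_left ?_ (by positivity)
  refine norm_integral_le_of_norm_le ?_ (Eventually.of_forall fun x => ?_)
  · exact (continuous_const.mul
      ((h.continuous_circle hr0.le hr.2).norm.pow n)).continuousOn.integrableOn_compact
        isCompact_Icc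
  · rw [norm_mul, norm_pow, norm_inv]
    have h1 : ‖z / (r * Complex.exp (x * Complex.I))‖ = ‖z‖ / r := by
      simp [Complex.norm_exp_ofReal_mul_I, abs_of_pos hr0]
    have h2 := norm_sub_norm_le 1 (z / (r * Complex.exp (x * Complex.I)))
    rw [h1, norm_one] at h2
    have h3 : ‖z‖ / r < 1 := (div_lt_one hr0).2 hr.1
    gcongr

/-- Inner functions are bounded by one. -/
lemma IsInner.norm_le_one {θ : ℂ → ℂ} (h : IsInner θ) {z : ℂ} (hz : ‖z‖ < 1) : ‖θ z‖ ≤ 1 := by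
  by_contra! hlt
  obtain ⟨n, hn⟩ := pow_unbounded_of_one_lt (1 - ‖z‖)⁻¹ hlt
  exact (hn.trans_le (h.norm_pow_le hz n)).false

/-! ### Monomials, and isometry of multiplication by inner functions. -/

namespace HardyBidisc

/-- The monomial `z^m w^n` as an element of `H²(𝔻²)`. -/
noncomputable def monomial (k : ℕ × ℕ) : HardyBidisc := coeffsEquiv.symm (lp.single 2 k 1)

lemma coeffs_monomial (k : ℕ × ℕ) : coeffs (monomial k) = lp.single 2 k 1 :=
  coeffsEquiv.apply_symm_apply _

lemma coeff_monomial (k j : ℕ × ℕ) : coeff (monomial k) j = if j = k then 1 else 0 := by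
  have h : coeff (monomial k) j = coeffs (monomial k) j := rfl
  rw [h, coeffs_monomial, lp.coeFn_single, Pi.single_apply]

lemma monomial_apply (k : ℕ × ℕ) {p : ℂ × ℂ} (hp : p ∈ bidisc) :
    monomial k p = HardyAux.mono k p := by
  refine (hasSum (monomial k) hp).unique ?_
  convert! hasSum_ite_eq k (HardyAux.mono k p) using 2 with j
  rw [coeff_monomial]
  split_ifs with h
  · subst h; simp [HardyAux.mono]
  · simp

lemma inner_monomial (k : ℕ × ℕ) (f : HardyBidisc) : inner ℂ (monomial k) f = coeff f k := by
  change inner ℂ (coeffs (monomial k)) (coeffs f) = _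
  rw [coeffs_monomial, lp.inner_single_left]
  simp [coeffs]

lemma sum_apply {ι : Type*} (s : Finset ι) (f : ι → HardyBidisc) (p : ℂ × ℂ) :
    (∑ i ∈ s, f i : HardyBidisc) p = ∑ i ∈ s, f i p := by
  classical
  induction s using Finset.induction_on with
  | empty => simp; rfl
  | insert i s hi ih =>
    rw [Finset.sum_insert hi, Finset.sum_insert hi, ← ih]
    rfl

lemma hasSum_monomial (f : HardyBidisc) : HasSum (fun k => coeff f k • monomial k) f := by
  have h := lp.hasSum_single (p := 2) (by norm_num) (coeffs f)
  have h2 := h.mapL (coeffsEquiv.symm.toContinuousLinearEquiv : _ →L[ℂ] HardyBidisc)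
  convert! h2 using 1
  · funext k
    change _ = coeffsEquiv.symm (lp.single 2 k (coeff f k))
    rw [monomial, ← map_smul, ← lp.single_smul]
    simp
  · exact (coeffsEquiv.symm_apply_apply f).symm

/-- For a polynomial g the square means of φg converge to the boundary mean of |g|², by dominated
convergence, while each of them is at most ‖φg‖². Polynomials are used because they have boundary
values on the whole torus. -/
lemma norm_le_norm_mulOp_polynomial {φ : ℂ × ℂ → ℂ} (hφ : DifferentiableOn ℂ φ bidisc)
    (hφ1 : ∀ p ∈ bidisc, ‖φ p‖ ≤ 1)
    (hlim : ∀ᵐ p : ℝ × ℝ, Tendsto (fun t => ‖φ (torusPt t p)‖) (𝓝[<] 1) (𝓝 1))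
    (s : Finset (ℕ × ℕ)) (c : ℕ × ℕ → ℂ) :
    ‖∑ k ∈ s, c k • monomial k‖ ≤ ‖mulOp φ hφ hφ1 (∑ k ∈ s, c k • monomial k)‖ := by
  set g : HardyBidisc := ∑ k ∈ s, c k • monomial k with hg
  have hgp : ∀ p ∈ bidisc, g p = ∑ k ∈ s, c k * HardyAux.mono k p := fun p hp => by
    rw [hg, sum_apply]
    refine Finset.sum_congr rfl fun k _ => ?_
    rw [← monomial_apply k hp]
    rfl
  have hcg : ∀ k ∉ s, coeff g k = 0 := fun k hk => by
    rw [← inner_monomial, hg, inner_sum]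
    refine Finset.sum_eq_zero fun j hj => ?_
    rw [inner_smul_right, inner_monomial, coeff_monomial, if_neg fun h : k = j => hk (h ▸ hj), mul_zero]
  have hcg' : ∀ k ∈ s, coeff g k = c k := fun k hk => by
    rw [← inner_monomial, hg, inner_sum, Finset.sum_eq_single k]
    · rw [inner_smul_right, inner_monomial, coeff_monomial, if_pos rfl, mul_one]
    · intro j _ hj
      rw [inner_smul_right, inner_monomial, coeff_monomial, if_neg hj.symm, mul_zero]
    · exact fun h => absurd hk h
  -- `g` is extended by zero outside the bidisc; `G` is the same polynomial on all of ℂ², hence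
  -- continuous up to t = 1.
  set G : ℂ × ℂ → ℂ := fun p => ∑ k ∈ s, c k * HardyAux.mono k p with hG
  have hGc : Continuous G := by
    simp only [hG, HardyAux.mono]; fun_prop
  have htorus : Continuous fun x : ℝ × (ℝ × ℝ) => torusPt x.1 x.2 := by
    simp only [torusPt]; fun_prop
  have hnorm : (4 * Real.pi ^ 2)⁻¹ * (∫ p in argBox, ‖G (torusPt 1 p)‖ ^ 2) = ‖g‖ ^ 2 := by
    have h1 : ∀ p, G (torusPt 1 p) = ∑' k, coeff g k * HardyAux.chr k p := fun p => by
      rw [tsum_eq_sum (s := s) fun k hk => by rw [hcg k hk, zero_mul]]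
      refine Finset.sum_congr rfl fun k hk => ?_
      rw [HardyAux.mono_torusPt, hcg' k hk]
      simp
    simp_rw [h1]
    rw [HardyAux.parseval (summable_of_ne_finset_zero (s := s) fun k hk => by
      rw [hcg k hk, norm_zero]), inv_mul_cancel_left₀ (by positivity)]
    have h2 := lp.hasSum_norm (p := 2) (by norm_num) (coeffs g)
    have h3 : HasSum (fun k => ‖coeff g k‖ ^ 2) (‖g‖ ^ 2) := by
      simpa [norm_coeffs] using! h2
    exact h3.tsum_eq
  obtain ⟨B, hB⟩ : ∃ B, ∀ x ∈ Icc (0 : ℝ) 1 ×ˢ argBox, ‖G (torusPt x.1 x.2)‖ ≤ B :=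
    (isCompact_Icc.prod HardyAux.isCompact_box).exists_bound_of_continuousOn
      (hGc.comp htorus).continuousOn
  have hT : Tendsto (fun t => sqMean t (mulOp φ hφ hφ1 g)) (𝓝[<] 1) (𝓝 (‖g‖ ^ 2)) := by
    rw [← hnorm]
    refine Tendsto.const_mul _ ?_
    refine tendsto_integral_filter_of_dominated_convergence (fun _ => B ^ 2) ?_ ?_ ?_ ?_
    · filter_upwards [eventually_mem_Ioo zero_lt_one] with t ht
      exact ((HardyAux.continuous_comp_torusPt (mulOp φ hφ hφ1 g).2.1 ht.1.le ht.2).norm.pow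
        2).aestronglyMeasurable
    · filter_upwards [eventually_mem_Ioo zero_lt_one] with t ht
      filter_upwards [ae_restrict_mem HardyAux.isCompact_box.measurableSet] with p hp
      have hm := HardyAux.torusPt_mem ht.1.le ht.2 p
      rw [norm_pow, norm_norm]
      refine pow_le_pow_left₀ (norm_nonneg _) ?_ 2
      change ‖φ (torusPt t p) * g (torusPt t p)‖ ≤ B
      rw [norm_mul, hgp _ hm]
      exact (mul_le_of_le_one_left (norm_nonneg _) (hφ1 _ hm)).trans
        (hB (t, p) ⟨⟨ht.1.le, ht.2.le⟩, hp⟩)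
    · exact integrable_const _
    · filter_upwards [ae_restrict_of_ae hlim] with p hp
      have h1 : Tendsto (fun t : ℝ => ‖G (torusPt t p)‖) (𝓝[<] 1) (𝓝 ‖G (torusPt 1 p)‖) :=
        ((hGc.comp (htorus.comp (continuous_id.prodMk continuous_const))).norm.tendsto
          (1 : ℝ)).mono_left nhdsWithin_le_nhds
      have h2 := (hp.mul h1).pow 2
      rw [one_mul] at h2
      refine h2.congr' ?_
      filter_upwards [eventually_mem_Ioo zero_lt_one] with t ht
      change _ = ‖φ (torusPt t p) * g (torusPt t p)‖ ^ 2
      rw [norm_mul, hgp _ (HardyAux.torusPt_mem ht.1.le ht.2 p)]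
  refine le_of_sq_le_sq ?_ (norm_nonneg _)
  refine le_of_tendsto hT ?_
  filter_upwards [eventually_mem_Ioo zero_lt_one] with t ht
  exact (isLUB_norm_sq _).1 ⟨t, ⟨ht.1.le, ht.2⟩, rfl⟩

/-- Multiplication by a function with unimodular radial limits is isometric. -/
lemma norm_mulOp {φ : ℂ × ℂ → ℂ} (hφ : DifferentiableOn ℂ φ bidisc)
    (hφ1 : ∀ p ∈ bidisc, ‖φ p‖ ≤ 1)
    (hlim : ∀ᵐ p : ℝ × ℝ, Tendsto (fun t => ‖φ (torusPt t p)‖) (𝓝[<] 1) (𝓝 1))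
    (g : HardyBidisc) : ‖mulOp φ hφ hφ1 g‖ = ‖g‖ := by
  refine le_antisymm ?_ ?_
  · refine ((mulOp φ hφ hφ1).le_opNorm g).trans ?_
    exact mul_le_of_le_one_left (norm_nonneg _) (LinearMap.mkContinuous_norm_le _ zero_le_one _)
  -- The lower bound passes from the partial sums of the Taylor series to their limit.
  · have h := g.hasSum_monomial
    exact le_of_tendsto_of_tendsto' h.norm (((mulOp φ hφ hφ1).continuous.tendsto g).comp h).norm
      fun s => norm_le_norm_mulOp_polynomial hφ hφ1 hlim s _

end HardyBidisc

/-! ### The coordinate shifts and their adjoints. -/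

namespace HardyBidisc

lemma M₁_apply (f : HardyBidisc) (p : ℂ × ℂ) : M₁ f p = p.1 * f p := rfl

lemma M₂_apply (f : HardyBidisc) (p : ℂ × ℂ) : M₂ f p = p.2 * f p := rfl

lemma add_apply (f g : HardyBidisc) (p : ℂ × ℂ) : (f + g) p = f p + g p := rfl

lemma sub_apply (f g : HardyBidisc) (p : ℂ × ℂ) : (f - g) p = f p - g p := rfl

lemma smul_apply (c : ℂ) (f : HardyBidisc) (p : ℂ × ℂ) : (c • f) p = c * f p := rfl

/-- The constant function `1` of `H²(𝔻²)`. -/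
noncomputable def one : HardyBidisc := monomial (0, 0)

lemma one_apply {p : ℂ × ℂ} (hp : p ∈ bidisc) : one p = 1 := by
  simp [one, monomial_apply _ hp, HardyAux.mono]

lemma zero_mem_bidisc : ((0, 0) : ℂ × ℂ) ∈ bidisc := by simp [HardyAux.mem_bidisc]

lemma mk_mem_bidisc {z w : ℂ} (hz : z ∈ Metric.ball (0 : ℂ) 1) (hw : w ∈ Metric.ball (0 : ℂ) 1) :
    (z, w) ∈ bidisc := ⟨hz, hw⟩

/-- The constant 1 is the reproducing kernel at the origin; the adjoints of multiplication operators
are evaluated on 1 through this. -/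
lemma inner_one (f : HardyBidisc) : inner ℂ one f = f (0, 0) := by
  rw [one, inner_monomial]
  refine HasSum.unique ?_ (f.hasSum zero_mem_bidisc)
  convert! hasSum_ite_eq ((0, 0) : ℕ × ℕ) (coeff f (0, 0)) using 2 with k
  obtain ⟨i, j⟩ := k
  split_ifs with h
  · simp_all
  · rw [Prod.mk.injEq, not_and_or] at h
    rcases h with h | h <;> simp [h]

lemma M₁_monomial (i j : ℕ) : M₁ (monomial (i, j)) = monomial (i + 1, j) :=
  ext_bidisc fun p hp => by
    rw [M₁_apply, monomial_apply _ hp, monomial_apply _ hp, HardyAux.mono, HardyAux.mono]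
    ring

lemma M₂_monomial (i j : ℕ) : M₂ (monomial (i, j)) = monomial (i, j + 1) :=
  ext_bidisc fun p hp => by
    rw [M₂_apply, monomial_apply _ hp, monomial_apply _ hp, HardyAux.mono, HardyAux.mono]
    ring

lemma coeff_adjoint_M₁ (f : HardyBidisc) (i j : ℕ) :
    coeff (ContinuousLinearMap.adjoint M₁ f) (i, j) = coeff f (i + 1, j) := by
  rw [← inner_monomial, ContinuousLinearMap.adjoint_inner_right, M₁_monomial, inner_monomial]

lemma coeff_adjoint_M₂ (f : HardyBidisc) (i j : ℕ) :
    coeff (ContinuousLinearMap.adjoint M₂ f) (i, j) = coeff f (i, j + 1) := by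
  rw [← inner_monomial, ContinuousLinearMap.adjoint_inner_right, M₂_monomial, inner_monomial]

/-- The adjoint of `M₁` is the backward shift in the first variable. -/
lemma mul_adjoint_M₁ (f : HardyBidisc) {z w : ℂ} (hp : (z, w) ∈ bidisc) :
    z * ContinuousLinearMap.adjoint M₁ f (z, w) = f (z, w) - f (0, w) := by
  have h1 := (hasSum (ContinuousLinearMap.adjoint M₁ f) hp).mul_left z
  have h0 : ((0 : ℂ), w) ∈ bidisc := mk_mem_bidisc (by simp) hp.2
  have h2 := (f.hasSum hp).sub (f.hasSum h0)
  refine h1.unique ?_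
  let e : ℕ × ℕ → ℕ × ℕ := fun k => (k.1 + 1, k.2)
  have he : Function.Injective e := fun a b h => by
    simp only [e, Prod.mk.injEq, add_left_inj] at h
    exact Prod.ext h.1 h.2
  rw [← he.hasSum_iff] at h2
  · convert! h2 using 2 with k
    obtain ⟨i, j⟩ := k
    simp only [coeff_adjoint_M₁, e, Function.comp]
    ring
  -- Indices missed by the shift have i = 0, and there the two series cancel because 0⁰ = 1.
  · rintro ⟨i, j⟩ hij
    cases i with
    | zero => simp
    | succ i => exact absurd ⟨(i, j), rfl⟩ hij

/-- The adjoint of `M₂` is the backward shift in the second variable. -/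
lemma mul_adjoint_M₂ (f : HardyBidisc) {z w : ℂ} (hp : (z, w) ∈ bidisc) :
    w * ContinuousLinearMap.adjoint M₂ f (z, w) = f (z, w) - f (z, 0) := by
  have h1 := (hasSum (ContinuousLinearMap.adjoint M₂ f) hp).mul_left w
  have h0 : (z, (0 : ℂ)) ∈ bidisc := mk_mem_bidisc hp.1 (by simp)
  have h2 := (f.hasSum hp).sub (f.hasSum h0)
  refine h1.unique ?_
  let e : ℕ × ℕ → ℕ × ℕ := fun k => (k.1, k.2 + 1)
  have he : Function.Injective e := fun a b h => by
    simp only [e, Prod.mk.injEq, add_left_inj] at h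
    exact Prod.ext h.1 h.2
  rw [← he.hasSum_iff] at h2
  · convert! h2 using 2 with k
    obtain ⟨i, j⟩ := k
    simp only [coeff_adjoint_M₂, e, Function.comp]
    ring
  · rintro ⟨i, j⟩ hij
    cases j with
    | zero => simp
    | succ j => exact absurd ⟨(i, j), rfl⟩ hij

lemma tendsto_norm_ofReal_mul_exp (x : ℝ) :
    Tendsto (fun t : ℝ => ‖(t * Complex.exp (x * Complex.I) : ℂ)‖) (𝓝[<] 1) (𝓝 1) := by
  have h : Continuous fun t : ℝ => ‖(t * Complex.exp (x * Complex.I) : ℂ)‖ := by fun_prop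
  simpa [Complex.norm_exp_ofReal_mul_I] using
    (h.tendsto 1).mono_left (nhdsWithin_le_nhds (s := Iio 1))

lemma adjoint_M₁_M₁ (f : HardyBidisc) : ContinuousLinearMap.adjoint M₁ (M₁ f) = f :=
  congrArg (· f) ((ContinuousLinearMap.norm_map_iff_adjoint_comp_self M₁).1 (norm_mulOp _ _
    (Eventually.of_forall fun p => tendsto_norm_ofReal_mul_exp p.1)))

lemma adjoint_M₂_M₂ (f : HardyBidisc) : ContinuousLinearMap.adjoint M₂ (M₂ f) = f :=
  congrArg (· f) ((ContinuousLinearMap.norm_map_iff_adjoint_comp_self M₂).1 (norm_mulOp _ _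
    (Eventually.of_forall fun p => tendsto_norm_ofReal_mul_exp p.2)))

lemma M₁_injective : Function.Injective M₁ :=
  Function.LeftInverse.injective adjoint_M₁_M₁

lemma M₂_injective : Function.Injective M₂ :=
  Function.LeftInverse.injective adjoint_M₂_M₂

lemma adjoint_M₂_one : ContinuousLinearMap.adjoint M₂ one = 0 :=
  M₂_injective <| ext_bidisc fun ⟨z, w⟩ hp => by
    rw [M₂_apply, mul_adjoint_M₂ _ hp, one_apply hp, one_apply (mk_mem_bidisc hp.1 (by simp)),
      sub_self, map_zero]
    rfl

/-- A factor `z` can be cancelled from an identity of continuous functions on the disc. -/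
lemma eqOn_ball_of_mul_left {F G : ℂ → ℂ} (hF : ContinuousOn F (Metric.ball 0 1))
    (hG : ContinuousOn G (Metric.ball 0 1))
    (h : ∀ z ∈ Metric.ball (0 : ℂ) 1, z * F z = z * G z) :
    ∀ z ∈ Metric.ball (0 : ℂ) 1, F z = G z := by
  intro z hz
  by_cases h0 : z = 0
  · subst h0
    have hn : Metric.ball (0 : ℂ) 1 ∈ 𝓝 (0 : ℂ) := Metric.isOpen_ball.mem_nhds hz
    have hF' := (hF.continuousAt hn).tendsto.mono_left (nhdsWithin_le_nhds (s := {0}ᶜ))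
    have hG' := (hG.continuousAt hn).tendsto.mono_left (nhdsWithin_le_nhds (s := {0}ᶜ))
    refine tendsto_nhds_unique_of_eventuallyEq hF' hG' ?_
    filter_upwards [nhdsWithin_le_nhds hn, self_mem_nhdsWithin] with z hz hz0
    exact mul_left_cancel₀ hz0 (h z hz)
  · exact mul_left_cancel₀ h0 (h z hz)

lemma continuousOn_fst (f : HardyBidisc) : ContinuousOn (fun z => f (z, 0)) (Metric.ball 0 1) :=
  f.2.1.continuousOn.comp (by fun_prop) fun _ hz => mk_mem_bidisc hz (by simp)

lemma continuousOn_snd (f : HardyBidisc) : ContinuousOn (fun w => f (0, w)) (Metric.ball 0 1) :=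
  f.2.1.continuousOn.comp (by fun_prop) fun _ hw => mk_mem_bidisc (by simp) hw

end HardyBidisc

/-! ### Multiplication by an inner function of one variable, and its adjoint. -/

namespace IsInner

open HardyBidisc

variable {θ : ℂ → ℂ}

/-- Multiplication by `θ(z)`. -/
noncomputable def mulFst (h : IsInner θ) : HardyBidisc →L[ℂ] HardyBidisc :=
  mulOp (fun p => θ p.1) (h.holo.comp differentiableOn_fst fun _ hp => hp.1)
    fun _ hp => h.norm_le_one (HardyAux.mem_bidisc.1 hp).1

/-- Multiplication by `θ(w)`. -/
noncomputable def mulSnd (h : IsInner θ) : HardyBidisc →L[ℂ] HardyBidisc :=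
  mulOp (fun p => θ p.2) (h.holo.comp differentiableOn_snd fun _ hp => hp.2)
    fun _ hp => h.norm_le_one (HardyAux.mem_bidisc.1 hp).2

lemma mulFst_apply (h : IsInner θ) (f : HardyBidisc) (p : ℂ × ℂ) :
    h.mulFst f p = θ p.1 * f p := rfl

lemma mulSnd_apply (h : IsInner θ) (f : HardyBidisc) (p : ℂ × ℂ) :
    h.mulSnd f p = θ p.2 * f p := rfl

/-- The modulus of θ(z) along (te^{iα}, te^{iβ}) depends on α alone, so almost every pair (α, β) has
limit 1 and the operator is isometric. -/
lemma adjoint_mulFst_mulFst (h : IsInner θ) (f : HardyBidisc) :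
    ContinuousLinearMap.adjoint h.mulFst (h.mulFst f) = f :=
  congrArg (· f) ((ContinuousLinearMap.norm_map_iff_adjoint_comp_self h.mulFst).1 (norm_mulOp _ _
    (Measure.quasiMeasurePreserving_fst.ae h.tendsto_norm)))

lemma adjoint_mulSnd_mulSnd (h : IsInner θ) (f : HardyBidisc) :
    ContinuousLinearMap.adjoint h.mulSnd (h.mulSnd f) = f :=
  congrArg (· f) ((ContinuousLinearMap.norm_map_iff_adjoint_comp_self h.mulSnd).1 (norm_mulOp _ _
    (Measure.quasiMeasurePreserving_snd.ae h.tendsto_norm)))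

lemma M₁_mulFst (h : IsInner θ) (f : HardyBidisc) : M₁ (h.mulFst f) = h.mulFst (M₁ f) :=
  ext_bidisc fun _ _ => mul_left_comm _ _ _

lemma M₁_mulSnd (h : IsInner θ) (f : HardyBidisc) : M₁ (h.mulSnd f) = h.mulSnd (M₁ f) :=
  ext_bidisc fun _ _ => mul_left_comm _ _ _

lemma M₂_mulFst (h : IsInner θ) (f : HardyBidisc) : M₂ (h.mulFst f) = h.mulFst (M₂ f) :=
  ext_bidisc fun _ _ => mul_left_comm _ _ _

lemma M₂_mulSnd (h : IsInner θ) (f : HardyBidisc) : M₂ (h.mulSnd f) = h.mulSnd (M₂ f) :=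
  ext_bidisc fun _ _ => mul_left_comm _ _ _

/-- θ(w) does not involve z, so it factors out of the difference f(z, w) - f(0, w) that defines the
backward shift. -/
lemma adjoint_M₁_mulSnd (h : IsInner θ) (f : HardyBidisc) :
    ContinuousLinearMap.adjoint M₁ (h.mulSnd f) = h.mulSnd (ContinuousLinearMap.adjoint M₁ f) :=
  M₁_injective <| ext_bidisc fun ⟨z, w⟩ hp => by
    rw [M₁_mulSnd, mulSnd_apply, M₁_apply, M₁_apply, mul_adjoint_M₁ _ hp, mul_adjoint_M₁ _ hp,
      mulSnd_apply, mulSnd_apply]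
    ring

lemma adjoint_M₂_mulFst (h : IsInner θ) (f : HardyBidisc) :
    ContinuousLinearMap.adjoint M₂ (h.mulFst f) = h.mulFst (ContinuousLinearMap.adjoint M₂ f) :=
  M₂_injective <| ext_bidisc fun ⟨z, w⟩ hp => by
    rw [M₂_mulFst, mulFst_apply, M₂_apply, M₂_apply, mul_adjoint_M₂ _ hp, mul_adjoint_M₂ _ hp,
      mulFst_apply, mulFst_apply]
    ring

/-- This is `adjoint_M₁_mulSnd` after taking adjoints. -/
lemma adjoint_mulSnd_M₁ (h : IsInner θ) (f : HardyBidisc) :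
    ContinuousLinearMap.adjoint h.mulSnd (M₁ f) = M₁ (ContinuousLinearMap.adjoint h.mulSnd f) :=
  ext_inner_right ℂ fun g => by
    rw [ContinuousLinearMap.adjoint_inner_left, ← ContinuousLinearMap.adjoint_inner_right,
      adjoint_M₁_mulSnd, ← ContinuousLinearMap.adjoint_inner_left,
      ContinuousLinearMap.adjoint_inner_right]

lemma adjoint_mulFst_M₂ (h : IsInner θ) (f : HardyBidisc) :
    ContinuousLinearMap.adjoint h.mulFst (M₂ f) = M₂ (ContinuousLinearMap.adjoint h.mulFst f) :=
  ext_inner_right ℂ fun g => by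
    rw [ContinuousLinearMap.adjoint_inner_left, ← ContinuousLinearMap.adjoint_inner_right,
      adjoint_M₂_mulFst, ← ContinuousLinearMap.adjoint_inner_left,
      ContinuousLinearMap.adjoint_inner_right]

/-- Pairing with g gives (θg)(0, 0) = θ(0) g(0, 0). -/
lemma adjoint_mulFst_one (h : IsInner θ) :
    ContinuousLinearMap.adjoint h.mulFst one = conj (θ 0) • one :=
  ext_inner_right ℂ fun g => by
    rw [ContinuousLinearMap.adjoint_inner_left, inner_one, inner_smul_left, inner_one,
      mulFst_apply, Complex.conj_conj]

lemma adjoint_mulSnd_one (h : IsInner θ) :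
    ContinuousLinearMap.adjoint h.mulSnd one = conj (θ 0) • one :=
  ext_inner_right ℂ fun g => by
    rw [ContinuousLinearMap.adjoint_inner_left, inner_one, inner_smul_left, inner_one,
      mulSnd_apply, Complex.conj_conj]

/-- The function `(θ(z) - θ(0)) / z`. -/
noncomputable def quot₁ (h : IsInner θ) (z : ℂ) : ℂ :=
  ContinuousLinearMap.adjoint M₁ (h.mulFst one) (z, 0)

/-- The function `(θ(w) - θ(0)) / w`. -/
noncomputable def quot₂ (h : IsInner θ) (w : ℂ) : ℂ :=
  ContinuousLinearMap.adjoint M₂ (h.mulSnd one) (0, w)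

lemma continuousOn_quot₁ (h : IsInner θ) : ContinuousOn h.quot₁ (Metric.ball 0 1) :=
  continuousOn_fst _

lemma continuousOn_quot₂ (h : IsInner θ) : ContinuousOn h.quot₂ (Metric.ball 0 1) :=
  continuousOn_snd _

lemma mul_quot₁ (h : IsInner θ) {z : ℂ} (hz : z ∈ Metric.ball (0 : ℂ) 1) :
    z * h.quot₁ z = θ z - θ 0 := by
  have hp := mk_mem_bidisc hz (Metric.mem_ball_self (x := (0 : ℂ)) one_pos)
  rw [quot₁, mul_adjoint_M₁ _ hp, mulFst_apply, mulFst_apply, one_apply hp,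
    one_apply zero_mem_bidisc, mul_one, mul_one]

lemma mul_quot₂ (h : IsInner θ) {w : ℂ} (hw : w ∈ Metric.ball (0 : ℂ) 1) :
    w * h.quot₂ w = θ w - θ 0 := by
  have hp := mk_mem_bidisc (Metric.mem_ball_self (x := (0 : ℂ)) one_pos) hw
  rw [quot₂, mul_adjoint_M₂ _ hp, mulSnd_apply, mulSnd_apply, one_apply hp,
    one_apply zero_mem_bidisc, mul_one, mul_one]

/-- A product rule: on w = 0, θg - θ(0)g(0, 0) = θ (g - g(0, 0)) + (θ - θ(0)) g(0, 0). Divide by z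
and let z = 0; `quot₁ 0` is θ'(0). -/
lemma adjoint_M₁_mulFst_apply_zero (h : IsInner θ) (g : HardyBidisc) :
    ContinuousLinearMap.adjoint M₁ (h.mulFst g) (0, 0) =
      θ 0 * ContinuousLinearMap.adjoint M₁ g (0, 0) + h.quot₁ 0 * g (0, 0) := by
  have h0 := Metric.mem_ball_self (x := (0 : ℂ)) one_pos
  refine eqOn_ball_of_mul_left (continuousOn_fst (ContinuousLinearMap.adjoint M₁ (h.mulFst g)))
    (G := fun z => θ z * ContinuousLinearMap.adjoint M₁ g (z, 0) + h.quot₁ z * g (0, 0))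
    ((h.holo.continuousOn.mul (continuousOn_fst _)).add
      (h.continuousOn_quot₁.mul continuousOn_const)) (fun z hz => ?_) 0 h0
  have hp := mk_mem_bidisc hz h0
  rw [mul_adjoint_M₁ _ hp, mulFst_apply, mulFst_apply, mul_add, mul_left_comm,
    mul_adjoint_M₁ _ hp, ← mul_assoc, h.mul_quot₁ hz]
  ring

lemma adjoint_M₂_mulSnd_apply_zero (h : IsInner θ) (g : HardyBidisc) :
    ContinuousLinearMap.adjoint M₂ (h.mulSnd g) (0, 0) =
      θ 0 * ContinuousLinearMap.adjoint M₂ g (0, 0) + h.quot₂ 0 * g (0, 0) := by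
  have h0 := Metric.mem_ball_self (x := (0 : ℂ)) one_pos
  refine eqOn_ball_of_mul_left (continuousOn_snd (ContinuousLinearMap.adjoint M₂ (h.mulSnd g)))
    (G := fun w => θ w * ContinuousLinearMap.adjoint M₂ g (0, w) + h.quot₂ w * g (0, 0))
    ((h.holo.continuousOn.mul (continuousOn_snd _)).add
      (h.continuousOn_quot₂.mul continuousOn_const)) (fun w hw => ?_) 0 h0
  have hp := mk_mem_bidisc h0 hw
  rw [mul_adjoint_M₂ _ hp, mulSnd_apply, mulSnd_apply, mul_add, mul_left_comm,
    mul_adjoint_M₂ _ hp, ← mul_assoc, h.mul_quot₂ hw]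
  ring

/-- The dual form of the product rule `adjoint_M₁_mulFst_apply_zero`, since pairing with z extracts
the value of M₁* at the origin. -/
lemma adjoint_mulFst_M₁_one (h : IsInner θ) :
    ContinuousLinearMap.adjoint h.mulFst (M₁ one) =
      conj (θ 0) • M₁ one + conj (h.quot₁ 0) • one :=
  ext_inner_right ℂ fun g => by
    rw [ContinuousLinearMap.adjoint_inner_left, ← ContinuousLinearMap.adjoint_inner_right,
      inner_one, adjoint_M₁_mulFst_apply_zero, inner_add_left, inner_smul_left, inner_smul_left,
      ← ContinuousLinearMap.adjoint_inner_right, inner_one, inner_one, Complex.conj_conj,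
      Complex.conj_conj]

lemma adjoint_mulSnd_M₂_one (h : IsInner θ) :
    ContinuousLinearMap.adjoint h.mulSnd (M₂ one) =
      conj (θ 0) • M₂ one + conj (h.quot₂ 0) • one :=
  ext_inner_right ℂ fun g => by
    rw [ContinuousLinearMap.adjoint_inner_left, ← ContinuousLinearMap.adjoint_inner_right,
      inner_one, adjoint_M₂_mulSnd_apply_zero, inner_add_left, inner_smul_left, inner_smul_left,
      ← ContinuousLinearMap.adjoint_inner_right, inner_one, inner_one, Complex.conj_conj,
      Complex.conj_conj]

end IsInner

/-! ### Compressions to a quotient module, and the degenerate cases giving sufficiency. -/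

namespace HardyBidisc

lemma coe_compression (Q : Submodule ℂ HardyBidisc) [CompleteSpace Q]
    (T : HardyBidisc →L[ℂ] HardyBidisc) (x : Q) :
    (compression Q T x : HardyBidisc) = Q.starProjection (T x) := rfl

lemma adjoint_compression (Q : Submodule ℂ HardyBidisc) [CompleteSpace Q]
    (T : HardyBidisc →L[ℂ] HardyBidisc) :
    ContinuousLinearMap.adjoint (compression Q T) =
      compression Q (ContinuousLinearMap.adjoint T) := by
  rw [compression, compression, ContinuousLinearMap.adjoint_comp,
    ContinuousLinearMap.adjoint_comp, Submodule.adjoint_orthogonalProjectionOnto,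
    Submodule.adjoint_subtypeL]
  rfl

/-- If T* preserves Q then T preserves Qᗮ, so the inner projection only discards a vector that the
outer one kills. Products of compressions thus become compressions of products. -/
lemma starProjection_comp_starProjection {Q : Submodule ℂ HardyBidisc} [CompleteSpace Q]
    {T : HardyBidisc →L[ℂ] HardyBidisc}
    (h : ∀ f ∈ Q, ContinuousLinearMap.adjoint T f ∈ Q) (x : HardyBidisc) :
    Q.starProjection (T (Q.starProjection x)) = Q.starProjection (T x) := by
  rw [← sub_eq_zero, ← map_sub, ← map_sub, Submodule.starProjection_apply_eq_zero_iff]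
  intro f hf
  rw [← ContinuousLinearMap.adjoint_inner_left, ← neg_sub, inner_neg_right,
    Q.sub_starProjection_mem_orthogonal x _ (h f hf), neg_zero]

/-- Working form of the relation: Q₂* is the restriction of M₂*, and all projections but one on each
side disappear. -/
lemma IsPhiDoublyCommuting.eq {Q : Submodule ℂ HardyBidisc} [CompleteSpace Q]
    (h : IsPhiDoublyCommuting Q) {f : HardyBidisc} (hf : f ∈ Q) :
    Q.starProjection (M₁ (M₂ (ContinuousLinearMap.adjoint M₂ f))) =
      ContinuousLinearMap.adjoint M₂ (Q.starProjection (M₁ (M₂ f))) := by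
  have h1 := congrArg (fun T : Q →L[ℂ] Q => (T ⟨f, hf⟩ : HardyBidisc)) h.2
  have hQ1 := starProjection_comp_starProjection fun f hf => (h.1.2 f hf).1
  simp only [adjoint_compression, ContinuousLinearMap.comp_apply, coe_compression, hQ1] at h1
  rwa [Submodule.starProjection_eq_self_iff.2 (h.1.2 f hf).2,
    Submodule.starProjection_eq_self_iff.2
      (h.1.2 _ (Submodule.starProjection_apply_mem _ _)).2] at h1

lemma isQuotientModule_productSubmodule (θ₁ θ₂ : ℂ → ℂ) :
    IsQuotientModule (productSubmodule θ₁ θ₂)ᗮ := by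
  refine ⟨Submodule.isClosed_orthogonal _, fun f hf => ⟨?_, ?_⟩⟩
  · rintro u ⟨g, hg⟩
    rw [ContinuousLinearMap.adjoint_inner_right]
    refine hf _ ⟨M₁ g, fun p hp => ?_⟩
    rw [M₁_apply, M₁_apply, hg p hp, mul_left_comm]
  · rintro u ⟨g, hg⟩
    rw [ContinuousLinearMap.adjoint_inner_right]
    refine hf _ ⟨M₂ g, fun p hp => ?_⟩
    rw [M₂_apply, M₂_apply, hg p hp, mul_left_comm]

lemma compression_eq_zero {Q : Submodule ℂ HardyBidisc} [CompleteSpace Q]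
    {T : HardyBidisc →L[ℂ] HardyBidisc}
    (h : ∀ f ∈ Q, ContinuousLinearMap.adjoint T f = 0) : compression Q T = 0 := by
  ext x
  change Q.starProjection (T x) = 0
  rw [Submodule.starProjection_apply_eq_zero_iff]
  intro f hf
  rw [← ContinuousLinearMap.adjoint_inner_left, h f hf, inner_zero_left]

lemma isPhiDoublyCommuting_of_adjoint_M₂_eq_smul {Q : Submodule ℂ HardyBidisc} [CompleteSpace Q]
    (hQ : IsQuotientModule Q) {c : ℂ}
    (h : ∀ f ∈ Q, ContinuousLinearMap.adjoint M₂ f = c • f) : IsPhiDoublyCommuting Q := by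
  have h1 : ContinuousLinearMap.adjoint (compression Q M₂) = c • ContinuousLinearMap.id ℂ Q := by
    rw [adjoint_compression]
    ext x
    rw [coe_compression, h x x.2, map_smul, Submodule.starProjection_eq_self_iff.2 x.2]
    rfl
  refine ⟨hQ, ?_⟩
  rw [h1]
  ext x
  simp

lemma isPhiDoublyCommuting_of_adjoint_M₁_eq_zero {Q : Submodule ℂ HardyBidisc} [CompleteSpace Q]
    (hQ : IsQuotientModule Q) (h : ∀ f ∈ Q, ContinuousLinearMap.adjoint M₁ f = 0) :
    IsPhiDoublyCommuting Q := by
  refine ⟨hQ, ?_⟩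
  simp [compression_eq_zero h]

lemma isPhiDoublyCommuting_of_adjoint_M₁_M₂_eq_zero {Q : Submodule ℂ HardyBidisc}
    [CompleteSpace Q] (hQ : IsQuotientModule Q)
    (h : ∀ f ∈ Q, ContinuousLinearMap.adjoint (M₁ ∘L M₂) f = 0) : IsPhiDoublyCommuting Q := by
  have h1 : compression Q M₁ ∘L compression Q M₂ = 0 := by
    rw [← compression_eq_zero h]
    ext x
    exact starProjection_comp_starProjection (fun f hf => (hQ.2 f hf).1) _
  refine ⟨hQ, ?_⟩
  rw [← ContinuousLinearMap.comp_assoc, h1, ContinuousLinearMap.zero_comp,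
    ContinuousLinearMap.comp_zero]

/-- Division by the outer factor `1 - b̄ w`. -/
lemma adjoint_M₂_eq_smul_of_blaschke {θ₁ θ₂ : ℂ → ℂ} {c₀ b c : ℂ} (hc₀ : c₀ ≠ 0) (hc : c ≠ 0)
    (hb : b ∈ Metric.ball (0 : ℂ) 1) (h₁ : ∀ z ∈ Metric.ball (0 : ℂ) 1, θ₁ z = c₀)
    (h₂ : ∀ w ∈ Metric.ball (0 : ℂ) 1, θ₂ w = c * ((w - b) / (1 - conj b * w)))
    {f : HardyBidisc} (hf : f ∈ (productSubmodule θ₁ θ₂)ᗮ) :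
    ContinuousLinearMap.adjoint M₂ f = conj b • f := by
  refine ext_inner_left ℂ fun g => ?_
  rw [ContinuousLinearMap.adjoint_inner_right, inner_smul_right, ← sub_eq_zero]
  have h : inner ℂ (M₂ g - b • g) f = 0 := by
    -- (w - b)g equals θ₁θ₂ times (c₀c)⁻¹(1 - b̄w)g, so it is orthogonal to f.
    refine hf _ ⟨(c₀ * c)⁻¹ • (g - conj b • M₂ g), fun p hp => ?_⟩
    have hne : 1 - conj b * p.2 ≠ 0 := by
      intro h0
      have h1 : ‖conj b * p.2‖ < 1 := by
        rw [norm_mul, RCLike.norm_conj]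
        have hb' : ‖b‖ < 1 := by simpa using hb
        have hp' := (HardyAux.mem_bidisc.1 hp).2
        nlinarith [norm_nonneg b, norm_nonneg p.2]
      rw [← sub_eq_zero.1 h0, norm_one] at h1
      exact h1.false
    rw [sub_apply, M₂_apply, smul_apply, h₁ _ hp.1, h₂ _ hp.2, smul_apply, sub_apply, smul_apply,
      M₂_apply]
    have h3 : c * ((p.2 - b) / (1 - conj b * p.2)) * (1 - conj b * p.2) = c * (p.2 - b) := by
      rw [mul_assoc, div_mul_cancel₀ _ hne]
    have h4 : (c₀ * c)⁻¹ * (c₀ * c) = 1 := inv_mul_cancel₀ (mul_ne_zero hc₀ hc)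
    linear_combination (-(g p * (c₀ * c)⁻¹ * c₀)) * h3 - (p.2 - b) * g p * h4
  rwa [inner_sub_left, inner_smul_left] at h

lemma adjoint_M₁_eq_zero_of_linear {θ₁ θ₂ : ℂ → ℂ} {c₀ c : ℂ} (hc₀ : c₀ ≠ 0) (hc : c ≠ 0)
    (h₁ : ∀ z ∈ Metric.ball (0 : ℂ) 1, θ₁ z = c * z)
    (h₂ : ∀ w ∈ Metric.ball (0 : ℂ) 1, θ₂ w = c₀)
    {f : HardyBidisc} (hf : f ∈ (productSubmodule θ₁ θ₂)ᗮ) :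
    ContinuousLinearMap.adjoint M₁ f = 0 := by
  refine ext_inner_left ℂ fun g => ?_
  rw [ContinuousLinearMap.adjoint_inner_right, inner_zero_right]
  refine hf _ ⟨(c₀ * c)⁻¹ • g, fun p hp => ?_⟩
  rw [M₁_apply, smul_apply, h₁ _ hp.1, h₂ _ hp.2]
  field_simp

lemma adjoint_M₁_M₂_eq_zero_of_linear {θ₁ θ₂ : ℂ → ℂ} {c₁ c₂ : ℂ} (hc₁ : c₁ ≠ 0) (hc₂ : c₂ ≠ 0)
    (h₁ : ∀ z ∈ Metric.ball (0 : ℂ) 1, θ₁ z = c₁ * z)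
    (h₂ : ∀ w ∈ Metric.ball (0 : ℂ) 1, θ₂ w = c₂ * w)
    {f : HardyBidisc} (hf : f ∈ (productSubmodule θ₁ θ₂)ᗮ) :
    ContinuousLinearMap.adjoint (M₁ ∘L M₂) f = 0 := by
  refine ext_inner_left ℂ fun g => ?_
  rw [ContinuousLinearMap.adjoint_inner_right, inner_zero_right]
  refine hf _ ⟨(c₁ * c₂)⁻¹ • g, fun p hp => ?_⟩
  rw [ContinuousLinearMap.comp_apply, M₁_apply, M₂_apply, smul_apply, h₁ _ hp.1, h₂ _ hp.2]
  field_simp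

lemma eq_zero_of_const {θ₁ θ₂ : ℂ → ℂ} {c₁ c₂ : ℂ} (hc₁ : c₁ ≠ 0) (hc₂ : c₂ ≠ 0)
    (h₁ : ∀ z ∈ Metric.ball (0 : ℂ) 1, θ₁ z = c₁)
    (h₂ : ∀ w ∈ Metric.ball (0 : ℂ) 1, θ₂ w = c₂)
    {f : HardyBidisc} (hf : f ∈ (productSubmodule θ₁ θ₂)ᗮ) : f = 0 := by
  refine ext_inner_left ℂ fun g => ?_
  rw [inner_zero_right]
  refine hf _ ⟨(c₁ * c₂)⁻¹ • g, fun p hp => ?_⟩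
  rw [smul_apply, h₁ _ hp.1, h₂ _ hp.2]
  field_simp

/-! ### The projection 1 - VV* and the two test vectors. -/

section Product

variable {θ₁ θ₂ : ℂ → ℂ}

lemma mem_productSubmodule (h₁ : IsInner θ₁) (h₂ : IsInner θ₂) (g : HardyBidisc) :
    h₁.mulFst (h₂.mulSnd g) ∈ productSubmodule θ₁ θ₂ :=
  ⟨g, fun _ _ => (mul_assoc _ _ _).symm⟩

lemma mem_orthogonal_productSubmodule (h₁ : IsInner θ₁) (h₂ : IsInner θ₂) (f : HardyBidisc) :
    f ∈ (productSubmodule θ₁ θ₂)ᗮ ↔ ContinuousLinearMap.adjoint h₂.mulSnd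
      (ContinuousLinearMap.adjoint h₁.mulFst f) = 0 := by
  constructor
  · intro hf
    refine ext_inner_left ℂ fun g => ?_
    rw [ContinuousLinearMap.adjoint_inner_right, ContinuousLinearMap.adjoint_inner_right,
      inner_zero_right]
    exact hf _ (mem_productSubmodule h₁ h₂ g)
  · rintro hf u ⟨g, hg⟩
    have : u = h₁.mulFst (h₂.mulSnd g) := ext_bidisc fun p hp => by
      rw [hg p hp, mul_assoc]; rfl
    rw [this, ← ContinuousLinearMap.adjoint_inner_right,
      ← ContinuousLinearMap.adjoint_inner_right, hf, inner_zero_right]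

/-- With V the isometry of multiplication by θ₁(z)θ₂(w), VV* is the projection onto its range. -/
lemma starProjection_orthogonal_productSubmodule (h₁ : IsInner θ₁) (h₂ : IsInner θ₂)
    (f : HardyBidisc) : (productSubmodule θ₁ θ₂)ᗮ.starProjection f =
      f - h₁.mulFst (h₂.mulSnd (ContinuousLinearMap.adjoint h₂.mulSnd
        (ContinuousLinearMap.adjoint h₁.mulFst f))) := by
  refine Submodule.eq_starProjection_of_mem_orthogonal ?_ ?_
  · rw [mem_orthogonal_productSubmodule h₁ h₂, map_sub, map_sub, h₁.adjoint_mulFst_mulFst,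
      h₂.adjoint_mulSnd_mulSnd, sub_self]
  · rw [sub_sub_cancel]
    exact Submodule.le_orthogonal_orthogonal _ (mem_productSubmodule h₁ h₂ _)

/-- Testing double commutativity on `θ₁(z) (1 - conj (θ₂(0)) θ₂(w))`. -/
lemma IsPhiDoublyCommuting.snd_eq (h₁ : IsInner θ₁) (h₂ : IsInner θ₂)
    (h : IsPhiDoublyCommuting (productSubmodule θ₁ θ₂)ᗮ) {w : ℂ}
    (hw : w ∈ Metric.ball (0 : ℂ) 1) :
    (1 - conj (θ₂ 0) * θ₂ 0) * (w * (1 - conj (θ₂ 0) * θ₂ w)) =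
      conj (h₂.quot₂ 0) * (θ₂ w - θ₂ 0) := by
  set a := θ₂ 0 with ha
  -- The projection of 1 onto the kernel of θ₂*, namely 1 - θ₂θ₂*1.
  set k : HardyBidisc := one - conj a • h₂.mulSnd one with hk
  have hmem : h₁.mulFst k ∈ (productSubmodule θ₁ θ₂)ᗮ := by
    rw [mem_orthogonal_productSubmodule h₁ h₂, h₁.adjoint_mulFst_mulFst, hk, map_sub, map_smul,
      h₂.adjoint_mulSnd_mulSnd, h₂.adjoint_mulSnd_one, sub_self]
  have hp0 := mk_mem_bidisc hw (Metric.mem_ball_self (x := (0 : ℂ)) one_pos)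
  have hM : M₂ (ContinuousLinearMap.adjoint M₂ (h₁.mulFst k)) =
      h₁.mulFst ((conj a * a) • one - conj a • h₂.mulSnd one) := ext_bidisc fun ⟨z, w⟩ hp => by
    have hp' : (z, (0 : ℂ)) ∈ bidisc := mk_mem_bidisc hp.1 (by simp)
    rw [M₂_apply, mul_adjoint_M₂ _ hp, h₁.mulFst_apply, h₁.mulFst_apply, h₁.mulFst_apply, hk]
    simp only [sub_apply, smul_apply, IsInner.mulSnd_apply, one_apply hp, one_apply hp', ← ha]
    ring
  have hV1 : ContinuousLinearMap.adjoint h₂.mulSnd (ContinuousLinearMap.adjoint h₁.mulFst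
      (M₁ (h₁.mulFst ((conj a * a) • one - conj a • h₂.mulSnd one)))) =
      (-conj a * (1 - conj a * a)) • M₁ one := by
    rw [h₁.M₁_mulFst, h₁.adjoint_mulFst_mulFst, h₂.adjoint_mulSnd_M₁, map_sub, map_smul, map_smul,
      h₂.adjoint_mulSnd_mulSnd, h₂.adjoint_mulSnd_one, ← ha, smul_smul, ← sub_smul, map_smul]
    congr 1
    ring
  have hV2 : ContinuousLinearMap.adjoint h₂.mulSnd (ContinuousLinearMap.adjoint h₁.mulFst
      (M₁ (M₂ (h₁.mulFst k)))) = conj (h₂.quot₂ 0) • M₁ one := by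
    rw [h₁.M₂_mulFst, h₁.M₁_mulFst, h₁.adjoint_mulFst_mulFst, h₂.adjoint_mulSnd_M₁, hk, map_sub,
      map_smul, h₂.M₂_mulSnd, map_sub, map_smul, h₂.adjoint_mulSnd_mulSnd,
      h₂.adjoint_mulSnd_M₂_one, ← ha, add_sub_cancel_left, map_smul]
  -- Multiplying by w turns the outer M₂* into subtraction of the value at w = 0.
  have e := congrArg M₂ (h.eq hmem)
  rw [starProjection_orthogonal_productSubmodule h₁ h₂,
    starProjection_orthogonal_productSubmodule h₁ h₂, hM, hV1, hV2] at e
  obtain ⟨z, hz, hz0, hθz⟩ := h₁.exists_ne_zero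
  have hp := mk_mem_bidisc hz hw
  have hp' : (z, (0 : ℂ)) ∈ bidisc := mk_mem_bidisc hz (by simp)
  have e1 := congrArg (fun f : HardyBidisc => f (z, w)) e
  simp only [M₂_apply, mul_adjoint_M₂ _ hp, sub_apply, smul_apply, IsInner.mulSnd_apply,
    IsInner.mulFst_apply, M₁_apply, one_apply hp, one_apply hp', hk, ← ha, mul_one] at e1
  refine mul_left_cancel₀ (mul_ne_zero hz0 hθz) ?_
  linear_combination -e1

/-- Testing double commutativity on `1 - conj (θ₁(0)) θ₁(z)`. -/
lemma IsPhiDoublyCommuting.fst_eq (h₁ : IsInner θ₁) (h₂ : IsInner θ₂)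
    (h : IsPhiDoublyCommuting (productSubmodule θ₁ θ₂)ᗮ) {z w : ℂ}
    (hz : z ∈ Metric.ball (0 : ℂ) 1) (hw : w ∈ Metric.ball (0 : ℂ) 1) :
    w * (z * (1 - conj (θ₁ 0) * θ₁ z)) = conj (h₁.quot₁ 0) * (θ₁ z *
      (w * (conj (θ₂ 0) * θ₂ w) + conj (h₂.quot₂ 0) * (θ₂ w - θ₂ 0))) := by
  set α := θ₁ 0 with hα
  set k : HardyBidisc := one - conj α • h₁.mulFst one with hk
  have hmem : k ∈ (productSubmodule θ₁ θ₂)ᗮ := by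
    rw [mem_orthogonal_productSubmodule h₁ h₂, hk, map_sub, map_smul,
      h₁.adjoint_mulFst_mulFst, h₁.adjoint_mulFst_one, sub_self, map_zero]
  -- The test vector is independent of w, so one side of the relation vanishes.
  have hM : ContinuousLinearMap.adjoint M₂ k = 0 := by
    rw [hk, map_sub, map_smul, h₁.adjoint_M₂_mulFst, adjoint_M₂_one, map_zero, smul_zero, sub_zero]
  have hV : ContinuousLinearMap.adjoint h₂.mulSnd (ContinuousLinearMap.adjoint h₁.mulFst
      (M₁ (M₂ k))) = conj (h₁.quot₁ 0) • (conj (θ₂ 0) • M₂ one + conj (h₂.quot₂ 0) • one) := by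
    have hcomm : M₁ (M₂ k) = M₂ (M₁ k) := ext_bidisc fun _ _ => mul_left_comm _ _ _
    rw [hcomm, h₁.adjoint_mulFst_M₂, hk, map_sub, map_smul, h₁.M₁_mulFst, map_sub, map_smul,
      h₁.adjoint_mulFst_mulFst, h₁.adjoint_mulFst_M₁_one, ← hα, add_sub_cancel_left, map_smul,
      map_smul, h₂.adjoint_mulSnd_M₂_one]
  have e := congrArg M₂ (h.eq hmem)
  rw [hM, map_zero, map_zero, map_zero, map_zero,
    starProjection_orthogonal_productSubmodule h₁ h₂, hV] at e
  have hp := mk_mem_bidisc hz hw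
  have hp' : (z, (0 : ℂ)) ∈ bidisc := mk_mem_bidisc hz (by simp)
  have e1 := congrArg (fun f : HardyBidisc => f (z, w)) e
  have h0 : (0 : HardyBidisc) (z, w) = 0 := rfl
  simp only [M₂_apply, mul_adjoint_M₂ _ hp, sub_apply, add_apply, smul_apply,
    IsInner.mulSnd_apply, IsInner.mulFst_apply, M₁_apply, one_apply hp, one_apply hp', hk,
    mul_one, h0] at e1
  linear_combination -e1

end Product

end HardyBidisc

/-! ### Solving the functional equations. -/

namespace IsInner

open HardyBidisc

/-- Pythagoras: θ has norm 1 and its projection onto the constants is θ(0). -/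
lemma inner_self_mulSnd_one_sub {θ : ℂ → ℂ} (h : IsInner θ) :
    inner ℂ (h.mulSnd one - θ 0 • one) (h.mulSnd one - θ 0 • one) = 1 - conj (θ 0) * θ 0 := by
  have h1 : inner ℂ (h.mulSnd one) (h.mulSnd one) = (1 : ℂ) := by
    rw [← ContinuousLinearMap.adjoint_inner_right, h.adjoint_mulSnd_mulSnd, inner_one,
      one_apply zero_mem_bidisc]
  have h2 : inner ℂ one (h.mulSnd one) = θ 0 := by
    rw [inner_one, mulSnd_apply, one_apply zero_mem_bidisc, mul_one]
  have h3 : inner ℂ (h.mulSnd one) one = conj (θ 0) := by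
    rw [← inner_conj_symm, h2]
  have h4 : inner ℂ one one = (1 : ℂ) := by rw [inner_one, one_apply zero_mem_bidisc]
  simp only [inner_sub_left, inner_sub_right, inner_smul_left, inner_smul_right, h1, h2, h3, h4]
  ring

/-- An inner function is constant or satisfies `|θ(0)| < 1`. -/
lemma eq_const_or_norm_lt {θ : ℂ → ℂ} (h : IsInner θ) :
    (∀ w ∈ Metric.ball (0 : ℂ) 1, θ w = θ 0) ∨ ‖θ 0‖ < 1 := by
  rw [or_iff_not_imp_right, not_lt]
  intro h1 w hw
  have h2 : ‖θ 0‖ = 1 := le_antisymm (h.norm_le_one (by simp)) h1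
  have h3 := h.inner_self_mulSnd_one_sub
  rw [Complex.conj_mul', h2, Complex.ofReal_one, one_pow, sub_self, inner_self_eq_zero,
    sub_eq_zero] at h3
  have hp := mk_mem_bidisc (Metric.mem_ball_self (x := (0 : ℂ)) one_pos) hw
  have h4 := congrArg (fun f : HardyBidisc => f (0, w)) h3
  simpa [mulSnd_apply, smul_apply, one_apply hp] using h4

/-- The functional equation of a Blaschke factor. -/
lemma eq_const_or_blaschke {θ : ℂ → ℂ} (h : IsInner θ)
    (he : ∀ w ∈ Metric.ball (0 : ℂ) 1, (1 - conj (θ 0) * θ 0) * (w * (1 - conj (θ 0) * θ w)) =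
      conj (h.quot₂ 0) * (θ w - θ 0)) :
    (∃ c : ℂ, ∀ w ∈ Metric.ball (0 : ℂ) 1, θ w = c) ∨
      ∃ b ∈ Metric.ball (0 : ℂ) 1, ∃ c : ℂ, ‖c‖ = 1 ∧
        ∀ w ∈ Metric.ball (0 : ℂ) 1, θ w = c * ((w - b) / (1 - conj b * w)) := by
  rcases h.eq_const_or_norm_lt with hc | ha
  · exact Or.inl ⟨_, hc⟩
  right
  set a := θ 0 with haa
  set d := h.quot₂ 0 with hd
  set n : ℝ := 1 - ‖a‖ ^ 2 with hn
  have hn0 : 0 < n := by nlinarith [norm_nonneg a]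
  have hnc : 1 - conj a * a = (n : ℂ) := by
    rw [Complex.conj_mul', hn]; push_cast; ring
  rw [hnc] at he
  have hnne : (n : ℂ) ≠ 0 := by exact_mod_cast hn0.ne'
  -- Dividing the equation by w and evaluating at 0 gives n² = |d|².
  have hq := eqOn_ball_of_mul_left
    (F := fun w => (n : ℂ) * (1 - conj a * θ w)) (G := fun w => conj d * h.quot₂ w)
    (continuousOn_const.mul (continuousOn_const.sub
      (continuousOn_const.mul h.holo.continuousOn)))
    (continuousOn_const.mul h.continuousOn_quot₂) (fun w hw => by
      rw [mul_left_comm, he w hw, mul_left_comm, h.mul_quot₂ hw]) 0 (by simp)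
  simp only [← haa, ← hd, hnc] at hq
  rw [Complex.conj_mul'] at hq
  have hdn : ‖d‖ = n := by
    have h1 : n * n = ‖d‖ ^ 2 := by exact_mod_cast hq
    nlinarith [norm_nonneg d]
  have hd0 : conj d ≠ 0 := by
    rw [← norm_pos_iff, RCLike.norm_conj, hdn]; exact hn0
  have hdd : conj d * d = (n : ℂ) * n := by rw [Complex.conj_mul', hdn, sq]
  have hnorm : ‖-(a * conj d / n)‖ = ‖a‖ := by
    rw [norm_neg, norm_div, norm_mul, RCLike.norm_conj, hdn, Complex.norm_real,
      Real.norm_of_nonneg hn0.le, mul_div_cancel_right₀ _ hn0.ne']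
  -- Solving for θ gives (nw + a d̄)/(d̄ + n ā w); factor out n/d̄ and use d̄ d = n² to recognise
  -- the denominator 1 - b̄w.
  refine ⟨-(a * conj d / n), by simpa [hnorm] using ha, n / conj d, ?_, fun w hw => ?_⟩
  · rw [norm_div, RCLike.norm_conj, hdn, Complex.norm_real, Real.norm_of_nonneg hn0.le,
      div_self hn0.ne']
  · have hne : 1 - conj (-(a * conj d / n)) * w ≠ 0 := by
      intro h0
      have h1 : ‖conj (-(a * conj d / n)) * w‖ < 1 := by
        rw [norm_mul, RCLike.norm_conj, hnorm]
        have hw' : ‖w‖ < 1 := by simpa using hw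
        nlinarith [norm_nonneg a, norm_nonneg w]
      rw [← sub_eq_zero.1 h0, norm_one] at h1
      exact h1.false
    rw [← mul_div_assoc, eq_div_iff hne]
    simp only [map_neg, map_div₀, map_mul, Complex.conj_conj, Complex.conj_ofReal]
    field_simp
    have := he w hw
    linear_combination (-(n : ℂ)) * this + conj a * w * θ w * hdd

end IsInner

open HardyBidisc in
-- Freezing w in `fst_eq` leaves z(1 - conj θ₁(0) θ₁) = Cθ₁. If C = 0, the bracket vanishes and θ₁
-- is constant; otherwise z = 0 forces θ₁(0) = 0, and then z = Cθ₁.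
lemma IsInner.eq_const_or_linear {θ₁ θ₂ : ℂ → ℂ} (h₁ : IsInner θ₁) (h₂ : IsInner θ₂)
    (h : IsPhiDoublyCommuting (productSubmodule θ₁ θ₂)ᗮ) :
    (∃ c : ℂ, ∀ z ∈ Metric.ball (0 : ℂ) 1, θ₁ z = c) ∨
      ∃ c₁ : ℂ, ‖c₁‖ = 1 ∧ ∀ z ∈ Metric.ball (0 : ℂ) 1, θ₁ z = c₁ * z := by
  have hw : (1 / 2 : ℂ) ∈ Metric.ball (0 : ℂ) 1 := by simp; norm_num
  obtain ⟨C, hC⟩ : ∃ C : ℂ, ∀ z ∈ Metric.ball (0 : ℂ) 1,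
      z * (1 - conj (θ₁ 0) * θ₁ z) = C * θ₁ z := by
    -- Any nonzero w would do; the factor 2 is 1/w for w = 1/2.
    refine ⟨2 * (conj (h₁.quot₁ 0) * ((1 / 2) * (conj (θ₂ 0) * θ₂ (1 / 2)) +
      conj (h₂.quot₂ 0) * (θ₂ (1 / 2) - θ₂ 0))), fun z hz => ?_⟩
    linear_combination 2 * h.fst_eq h₁ h₂ hz hw
  by_cases hC0 : C = 0
  · left
    have h1 := eqOn_ball_of_mul_left (F := fun z => 1 - conj (θ₁ 0) * θ₁ z) (G := fun _ => 0)
      (continuousOn_const.sub (continuousOn_const.mul h₁.holo.continuousOn)) continuousOn_const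
      fun z hz => by rw [hC z hz, hC0]; ring
    refine ⟨(conj (θ₁ 0))⁻¹, fun z hz => ?_⟩
    exact eq_inv_of_mul_eq_one_right (sub_eq_zero.1 (h1 z hz)).symm
  · right
    have h0 : θ₁ 0 = 0 := by
      have := hC 0 (by simp)
      rw [zero_mul, zero_eq_mul] at this
      exact this.resolve_left hC0
    have h1 : ∀ z ∈ Metric.ball (0 : ℂ) 1, θ₁ z = C⁻¹ * z := fun z hz => by
      have := hC z hz
      rw [h0, map_zero, zero_mul, sub_zero, mul_one] at this
      rw [eq_inv_mul_iff_mul_eq₀ hC0, ← this]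
    exact ⟨_, h₁.norm_linear h1, h1⟩

open HardyBidisc in
-- The two test equations now differ only by the factor 1 - |a|² with a = θ₂(0), so either a = 0 or
-- 1 - ā θ₂ vanishes identically.
lemma IsInner.snd_eq_const_or_linear {θ₁ θ₂ : ℂ → ℂ} (h₁ : IsInner θ₁) (h₂ : IsInner θ₂)
    (h : IsPhiDoublyCommuting (productSubmodule θ₁ θ₂)ᗮ) {c₁ : ℂ} (hc₁ : ‖c₁‖ = 1)
    (hθ₁ : ∀ z ∈ Metric.ball (0 : ℂ) 1, θ₁ z = c₁ * z) :
    (∃ c : ℂ, ∀ w ∈ Metric.ball (0 : ℂ) 1, θ₂ w = c) ∨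
      ∃ c₂ : ℂ, ‖c₂‖ = 1 ∧ ∀ w ∈ Metric.ball (0 : ℂ) 1, θ₂ w = c₂ * w := by
  have h0 : θ₁ 0 = 0 := by rw [hθ₁ 0 (by simp), mul_zero]
  have hq : h₁.quot₁ 0 = c₁ := eqOn_ball_of_mul_left h₁.continuousOn_quot₁
    (continuousOn_const (c := c₁)) (fun z hz => by
      rw [h₁.mul_quot₁ hz, h0, hθ₁ z hz]; ring) 0 (by simp)
  have hcc : conj c₁ * c₁ = 1 := by rw [Complex.conj_mul', hc₁]; simp
  have hz : (1 / 2 : ℂ) ∈ Metric.ball (0 : ℂ) 1 := by simp; norm_num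
  have key : ∀ w ∈ Metric.ball (0 : ℂ) 1,
      w = w * (conj (θ₂ 0) * θ₂ w) + conj (h₂.quot₂ 0) * (θ₂ w - θ₂ 0) := fun w hw => by
    have e := h.fst_eq h₁ h₂ hz hw
    rw [h0, map_zero, hq, hθ₁ _ hz] at e
    linear_combination 2 * e + (w * (conj (θ₂ 0) * θ₂ w) +
      conj (h₂.quot₂ 0) * (θ₂ w - θ₂ 0)) * hcc
  by_cases ha : θ₂ 0 = 0
  · right
    simp only [ha, map_zero, zero_mul, mul_zero, zero_add, sub_zero] at key
    have hd : conj (h₂.quot₂ 0) ≠ 0 := fun h => by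
      have := key _ hz
      rw [h, zero_mul] at this
      norm_num at this
    have h1 : ∀ w ∈ Metric.ball (0 : ℂ) 1, θ₂ w = (conj (h₂.quot₂ 0))⁻¹ * w := fun w hw => by
      conv_rhs => rw [key w hw]
      rw [inv_mul_cancel_left₀ hd]
    exact ⟨_, h₂.norm_linear h1, h1⟩
  · left
    have h1 := eqOn_ball_of_mul_left (F := fun w => 1 - conj (θ₂ 0) * θ₂ w) (G := fun _ => 0)
      (continuousOn_const.sub (continuousOn_const.mul h₂.holo.continuousOn)) continuousOn_const
      fun w hw => by
        have e := h.snd_eq h₁ h₂ hw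
        have hne : conj (θ₂ 0) * θ₂ 0 ≠ 0 :=
          mul_ne_zero ((map_ne_zero _).2 ha) ha
        refine mul_left_cancel₀ hne ?_
        linear_combination key w hw - e
    refine ⟨(conj (θ₂ 0))⁻¹, fun w hw => ?_⟩
    exact eq_inv_of_mul_eq_one_right (sub_eq_zero.1 (h1 w hw)).symm

theorem theorem3p9 (θ₁ θ₂ : ℂ → ℂ) (h₁ : IsInner θ₁) (h₂ : IsInner θ₂) :
    HardyBidisc.IsPhiDoublyCommuting (HardyBidisc.productSubmodule θ₁ θ₂)ᗮ ↔
      ((∃ c : ℂ, ∀ z ∈ Metric.ball (0 : ℂ) 1, θ₁ z = c) ∧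
        (∃ c : ℂ, ∀ w ∈ Metric.ball (0 : ℂ) 1, θ₂ w = c)) ∨
      ((∃ c : ℂ, ∀ z ∈ Metric.ball (0 : ℂ) 1, θ₁ z = c) ∧
        (∃ b ∈ Metric.ball (0 : ℂ) 1, ∃ c : ℂ, ‖c‖ = 1 ∧
          ∀ w ∈ Metric.ball (0 : ℂ) 1, θ₂ w = c * ((w - b) / (1 - conj b * w)))) ∨
      ((∃ c : ℂ, ∀ w ∈ Metric.ball (0 : ℂ) 1, θ₂ w = c) ∧
        (∃ c₁ : ℂ, ‖c₁‖ = 1 ∧ ∀ z ∈ Metric.ball (0 : ℂ) 1, θ₁ z = c₁ * z)) ∨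
      ((∃ c₁ : ℂ, ‖c₁‖ = 1 ∧ ∀ z ∈ Metric.ball (0 : ℂ) 1, θ₁ z = c₁ * z) ∧
        (∃ c₂ : ℂ, ‖c₂‖ = 1 ∧ ∀ w ∈ Metric.ball (0 : ℂ) 1, θ₂ w = c₂ * w)) := by
  have hne : ∀ {c : ℂ}, ‖c‖ = 1 → c ≠ 0 := fun hc h => by simp [h] at hc
  constructor
  · intro h
    rcases h₁.eq_const_or_linear h₂ h with hc | ⟨c₁, hc₁, hθ₁⟩
    -- The equation for θ₂ holds whatever θ₁ is, and here it is the only constraint.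
    · rcases h₂.eq_const_or_blaschke fun w hw => h.snd_eq h₁ h₂ hw with hc' | hb
      · exact Or.inl ⟨hc, hc'⟩
      · exact Or.inr (Or.inl ⟨hc, hb⟩)
    · rcases h₁.snd_eq_const_or_linear h₂ h hc₁ hθ₁ with hc' | hl
      · exact Or.inr (Or.inr (Or.inl ⟨hc', c₁, hc₁, hθ₁⟩))
      · exact Or.inr (Or.inr (Or.inr ⟨⟨c₁, hc₁, hθ₁⟩, hl⟩))
  · have hQ := HardyBidisc.isQuotientModule_productSubmodule θ₁ θ₂
    rintro (⟨⟨c₁, hθ₁⟩, c₂, hθ₂⟩ | ⟨⟨c₁, hθ₁⟩, b, hb, c, hc, hθ₂⟩ | ⟨⟨c₂, hθ₂⟩, c₁, hc₁, hθ₁⟩ |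
      ⟨⟨c₁, hc₁, hθ₁⟩, c₂, hc₂, hθ₂⟩)
    · refine HardyBidisc.isPhiDoublyCommuting_of_adjoint_M₁_eq_zero hQ fun f hf => ?_
      rw [HardyBidisc.eq_zero_of_const (hne (h₁.norm_const hθ₁)) (hne (h₂.norm_const hθ₂))
        hθ₁ hθ₂ hf, map_zero]
    · exact HardyBidisc.isPhiDoublyCommuting_of_adjoint_M₂_eq_smul hQ fun f hf =>
        HardyBidisc.adjoint_M₂_eq_smul_of_blaschke (hne (h₁.norm_const hθ₁)) (hne hc) hb hθ₁ hθ₂ hf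
    · exact HardyBidisc.isPhiDoublyCommuting_of_adjoint_M₁_eq_zero hQ fun f hf =>
        HardyBidisc.adjoint_M₁_eq_zero_of_linear (hne (h₂.norm_const hθ₂)) (hne hc₁) hθ₁ hθ₂ hf
    · exact HardyBidisc.isPhiDoublyCommuting_of_adjoint_M₁_M₂_eq_zero hQ fun f hf =>
        HardyBidisc.adjoint_M₁_M₂_eq_zero_of_linear (hne hc₁) (hne hc₂) hθ₁ hθ₂ hf
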